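/- Conventions. A topological groupoid $\mathsf G$ has spaces of objects $\mathsf G_0$ and arrows $\mathsf G_1$ and continuous structure maps $s,t,e,i,m$; the product $a\cdot b$ means "first $a$, then $b$". A morphism $F:\mathsf H\to\mathsf G$ (a pair of continuous maps $F_0,F_1$ compatible with the structure maps) is \emph{Morita} if $\mathsf H_1\to(\mathsf H_0\times\mathsf H_0)\times_{\mathsf G_0\times\mathsf G_0}\mathsf G_1$, $a\mapsto((s(a),t(a)),F_1(a))$, is a homeomorphism and $s\pi_2:\mathsf H_0\,{}_{F_0}\!\times_{t}\mathsf G_1\to\mathsf G_0$ is an open surjection; two topological groupoids are \emph{Morita equivalent} if some topological groupoid admits Morita morphisms to both. An \emph{orbifold groupoid} is a proper étale smooth groupoid: $\mathsf G_0,\mathsf G_1$ are Hausdorff smooth manifolds of some dimension $n$ (not necessarily second countable), $s,t$ are local diffeomorphisms, and $(s,t):\mathsf G_1\to\mathsf G_0\times\mathsf G_0$ is proper. Loop groupoid. An admissible cover $W$ is given by a nonempty finite set of points of $S^1=\mathbb R/\mathbb Z$ and $\epsilon>0$ such that the intervals $W_a=(a-\epsilon,a^++\epsilon)\subset\mathbb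 R$ have empty triple intersections; here $a$ runs over the set of all lifts to $\mathbb R$ of the chosen points and $a^+$ is the next lift after $a$. Let $\mathsf S^1_W$ be the groupoid with objects $\bigsqcup_a W_a$ and arrows $\bigl(\bigsqcup_{a,b}W_a\cap W_b\bigr)\times\mathbb Z$, where $((x,a,b),l)$ goes from $(x,a)$ to $(x+l,b+l)$. $\mathsf{LG}(W)$ is the groupoid whose objects are the morphisms $\Psi:\mathsf S^1_W\to\mathsf G$ and whose arrows $\Psi\to\Phi$ are the continuous maps $\Lambda:(\mathsf S^1_W)_1\to\mathsf G_1$ over $(\Psi_0,\Phi_0)$ with $\Lambda(r)=\Psi_1(r)\cdot\Lambda(et(r))=\Lambda(es(r))\cdot\Phi_1(r)$, with compact-open topologies. A cover $W'$ refines $W$ if it has at least the points of $W$ and $\epsilon'\le\epsilon$; then $W'_{a'}\subset W_a$ for $a$ the largest lift for $W$ with $a\le a'$, which induces $\mathsf S^1_{W'}\to\mathsf S^1_W$ and $\mathsf{LG}(W)\to\mathsf{LG}(W')$. The \emph{loop groupoid} is $\mathsf{LG}=\varinjlim_W\mathsf{LG}(W)$ over all admissible covers, with the colimit topologies. Each $z\in\mathbb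 R$ acts on $\mathsf{LG}$ by sending $\Psi$ on $W$ to $\Psi^z$ on the cover translated by $z$, $\Psi^z_1((x,a,b),l)=\Psi_1((x-z,a-z,b-z),l)$, and similarly on arrows. $\mathsf{LG}^{\mathbb R}$ is the subgroupoid of objects and arrows fixed by all $z\in\mathbb R$, with the subspace topologies. Twisted sectors. For $x\in\mathsf G_0$ let $G_x$ be its isotropy group. An orbifold chart at $x$ is a connected open neighbourhood $V$ of $x$ in $\mathsf G_0$ with a right action of $G_x$ and an isomorphism of topological groupoids, identical on objects, of the action groupoid $V\rtimes G_x$ with the restriction $\mathsf G|_V$, taking $(x,g)$ to $g$. An orbifold atlas consists, for each point $p$ of the orbit space, of a representative $x_p\in\mathsf G_0$, an orbifold chart $(V_p,G_p)$ at $x_p$ with $G_p=G_{x_p}$, and a representative $g$ of each conjugacy class $(g)$ of $G_p$. The (Kawasaki/Ruan) twisted-sector groupoid $\widetilde{\Sigma_1\mathsf G}$ has as objects the disjoint union $\bigsqcup_{(p,(g))}V_p^g$ of fixed-point sets over all $p$ and all conjugacy classes $(g)\subset G_p$; its arrows from $y\in V_p^g$ to $y'\in V_q^h$ are the arrows $\alpha:y\to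 y'$ of $\mathsf G$ with $g_y\cdot\alpha=\alpha\cdot h_{y'}$, where $g_y\in\mathsf G_1$ is the arrow $y\to y$ corresponding to $(y,g)$ (topologized as a subspace of the product of objects, $\mathsf G_1$ and objects). Its restriction to $V_p^g$ is the action groupoid of the centralizer $C(g)$ on $V_p^g$. Theorem. Let $\mathsf G$ be an orbifold groupoid. Then $\mathsf G$ has an orbifold atlas, and for every orbifold atlas the fixed loop groupoid $\mathsf{LG}^{\mathbb R}$ and the twisted-sector groupoid $\widetilde{\Sigma_1\mathsf G}$ are topological groupoids that are Morita equivalent. -/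

import Mathlib

open scoped Manifold ContDiff

universe u v w

/-- A groupoid (small category with all morphisms invertible) presented by its set of objects, its
set of arrows and its structure maps, together with a topology on objects and on arrows. No
compatibility is required here, see `TGpd.IsTopological`. Composition is written in diagrammatic
order: `comp a b` is "first `a`, then `b`", and makes sense when the target of `a` is the source
of `b`. -/
structure TGpd where
  Obj : Type u
  Arr : Type u
  [topObj : TopologicalSpace Obj]
  [topArr : TopologicalSpace Arr]
  src : Arr → Obj
  tgt : Arr → Obj
  unit : Obj → Arr
  inv : Arr → Arr
  comp : (a b : Arr) → tgt a = src b → Arr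
  src_unit : ∀ x, src (unit x) = x
  tgt_unit : ∀ x, tgt (unit x) = x
  src_inv : ∀ a, src (inv a) = tgt a
  tgt_inv : ∀ a, tgt (inv a) = src a
  src_comp : ∀ a b h, src (comp a b h) = src a
  tgt_comp : ∀ a b h, tgt (comp a b h) = tgt b
  unit_comp : ∀ a, comp (unit (src a)) a (tgt_unit _) = a
  comp_unit : ∀ a, comp a (unit (tgt a)) (src_unit _).symm = a
  inv_comp : ∀ a, comp (inv a) a (tgt_inv a) = unit (tgt a)
  comp_inv : ∀ a, comp a (inv a) (src_inv a).symm = unit (src a)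
  assoc : ∀ a b c hab hbc,
    comp (comp a b hab) c ((tgt_comp a b hab).trans hbc) =
      comp a (comp b c hbc) (hab.trans (src_comp b c hbc).symm)

attribute [instance] TGpd.topObj TGpd.topArr

namespace TGpd

/-- A topological groupoid: all the structure maps are continuous. -/
class IsTopological (G : TGpd.{u}) : Prop where
  continuous_src : Continuous G.src
  continuous_tgt : Continuous G.tgt
  continuous_unit : Continuous G.unit
  continuous_inv : Continuous G.inv
  continuous_comp :
    Continuous fun p : {p : G.Arr × G.Arr // G.tgt p.1 = G.src p.2} => G.comp p.1.1 p.1.2 p.2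

attribute [simp] src_unit tgt_unit src_inv tgt_inv src_comp tgt_comp

section Algebra

variable (G : TGpd.{u})

theorem comp_congr {a a' b b' : G.Arr} (ha : a = a') (hb : b = b') (h : G.tgt a = G.src b) :
    G.comp a b h = G.comp a' b' (by rw [← ha, ← hb, h]) := by
  subst ha; subst hb; rfl

theorem unit_comp_of {x : G.Obj} {a : G.Arr} (h : G.tgt (G.unit x) = G.src a) :
    G.comp (G.unit x) a h = a := by
  have hx : x = G.src a := by rw [← h, G.tgt_unit]
  subst hx
  exact G.unit_comp a

theorem comp_unit_of {x : G.Obj} {a : G.Arr} (h : G.tgt a = G.src (G.unit x)) :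
    G.comp a (G.unit x) h = a := by
  have hx : x = G.tgt a := by rw [h, G.src_unit]
  subst hx
  exact G.comp_unit a

theorem inv_comp_cancel {a b : G.Arr} (h : G.tgt a = G.src b)
    (h' : G.tgt (G.inv a) = G.src (G.comp a b h)) : G.comp (G.inv a) (G.comp a b h) h' = b := by
  rw [← G.assoc _ _ _ (G.tgt_inv a) h]
  rw [G.comp_congr (G.inv_comp a) rfl]
  exact G.unit_comp_of _

theorem comp_inv_cancel {a b : G.Arr} (h : G.tgt (G.inv a) = G.src b)
    (h' : G.tgt a = G.src (G.comp (G.inv a) b h)) : G.comp a (G.comp (G.inv a) b h) h' = b := by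
  rw [← G.assoc _ _ _ (G.src_inv a).symm h]
  rw [G.comp_congr (G.comp_inv a) rfl]
  exact G.unit_comp_of _

theorem continuous_comp_of [G.IsTopological] {X : Type*} [TopologicalSpace X] {a b : X → G.Arr}
    (ha : Continuous a) (hb : Continuous b) (h : ∀ x, G.tgt (a x) = G.src (b x)) :
    Continuous fun x => G.comp (a x) (b x) (h x) :=
  (IsTopological.continuous_comp (G := G)).comp ((ha.prodMk hb).subtype_mk h)

end Algebra

/-- A morphism of groupoids with topologies: continuous maps on objects and arrows commuting with
the structure maps (compatibility with inverses is automatic). -/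
structure Hom (H : TGpd.{v}) (G : TGpd.{u}) where
  obj : C(H.Obj, G.Obj)
  arr : C(H.Arr, G.Arr)
  src_arr : ∀ a, G.src (arr a) = obj (H.src a)
  tgt_arr : ∀ a, G.tgt (arr a) = obj (H.tgt a)
  arr_unit : ∀ x, arr (H.unit x) = G.unit (obj x)
  arr_comp : ∀ a b h, arr (H.comp a b h) =
    G.comp (arr a) (arr b) ((tgt_arr a).trans ((congrArg obj h).trans (src_arr b).symm))

namespace Hom

attribute [simp] src_arr tgt_arr arr_unit

theorem ext' {H : TGpd.{v}} {G : TGpd.{u}} {F F' : Hom H G} (h0 : ∀ x, F.obj x = F'.obj x)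
    (h1 : ∀ a, F.arr a = F'.arr a) : F = F' := by
  cases F; cases F'
  congr
  · exact ContinuousMap.ext h0
  · exact ContinuousMap.ext h1

theorem arr_inv {H : TGpd.{v}} {G : TGpd.{u}} (F : Hom H G) (a : H.Arr) :
    F.arr (H.inv a) = G.inv (F.arr a) := by
  have h1 := F.arr_comp _ _ (H.tgt_inv a)
  rw [H.inv_comp, F.arr_unit] at h1
  have h2 : G.tgt (F.arr (H.inv a)) = G.src (F.arr a) := by simp
  have h3 : G.comp (G.comp (F.arr (H.inv a)) (F.arr a) h2) (G.inv (F.arr a)) (by simp) =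
      F.arr (H.inv a) := by
    rw [G.assoc _ _ _ h2 (by simp), G.comp_congr rfl (G.comp_inv _)]
    exact G.comp_unit_of _
  rw [← h3, G.comp_congr h1.symm rfl]
  exact G.unit_comp_of _

/-- Composition of morphisms. -/
def trans {K : TGpd.{w}} {H : TGpd.{v}} {G : TGpd.{u}} (E : Hom K H) (F : Hom H G) : Hom K G where
  obj := F.obj.comp E.obj
  arr := F.arr.comp E.arr
  src_arr a := by simp
  tgt_arr a := by simp
  arr_unit x := by simp
  arr_comp a b h := by
    simp only [ContinuousMap.comp_apply, E.arr_comp, F.arr_comp]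

/-- A morphism `F : H → G` is Morita if the square formed by `(s, t)` on `H` and on `G` is
cartesian in topological spaces, and if the map `s ∘ π₂ : H₀ ×_{F₀, t} G₁ → G₀` is an open
surjection. -/
structure IsMorita {H : TGpd.{v}} {G : TGpd.{u}} (F : Hom H G) : Prop where
  cartesian : IsHomeomorph fun a : H.Arr =>
    (⟨((H.src a, H.tgt a), F.arr a), F.src_arr a, F.tgt_arr a⟩ :
      {p : (H.Obj × H.Obj) × G.Arr // G.src p.2 = F.obj p.1.1 ∧ G.tgt p.2 = F.obj p.1.2})
  surjective : Function.Surjective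
    fun p : {p : H.Obj × G.Arr // F.obj p.1 = G.tgt p.2} => G.src p.1.2
  isOpenMap : IsOpenMap
    fun p : {p : H.Obj × G.Arr // F.obj p.1 = G.tgt p.2} => G.src p.1.2

end Hom

/-- Two topological groupoids are Morita equivalent if some topological groupoid maps to both of
them by Morita morphisms. (That `G` and `H` are topological groupoids is part of the assertion.) -/
def MoritaEquivalent (G H : TGpd.{u}) : Prop :=
  G.IsTopological ∧ H.IsTopological ∧
    ∃ K : TGpd.{u}, K.IsTopological ∧
      ∃ (E : Hom K G) (F : Hom K H), E.IsMorita ∧ F.IsMorita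

/-! ### The groupoid of morphisms between two groupoids -/

/-- An arrow from `dom` to `cod` between two morphisms `K → G`: a continuous map
`Λ : K₁ → G₁` lying over `(dom₀, cod₀)` with
`Λ(r) = dom₁(r) · Λ(e t r) = Λ(e s r) · cod₁(r)`. -/
structure MapArr (K : TGpd.{v}) (G : TGpd.{u}) where
  dom : Hom K G
  cod : Hom K G
  app : C(K.Arr, G.Arr)
  src_app : ∀ r, G.src (app r) = dom.obj (K.src r)
  tgt_app : ∀ r, G.tgt (app r) = cod.obj (K.tgt r)
  app_eq_left : ∀ r, app r = G.comp (dom.arr r) (app (K.unit (K.tgt r)))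
    (by rw [dom.tgt_arr, src_app, K.src_unit])
  app_eq_right : ∀ r, app r = G.comp (app (K.unit (K.src r))) (cod.arr r)
    (by rw [cod.src_arr, tgt_app, K.tgt_unit])

namespace MapArr

variable {K : TGpd.{v}} {G : TGpd.{u}}

attribute [simp] src_app tgt_app

theorem ext' {L M : MapArr K G} (hd : L.dom = M.dom) (hc : L.cod = M.cod)
    (ha : ∀ r, L.app r = M.app r) : L = M := by
  cases L; cases M
  simp only at hd hc ha
  subst hd; subst hc
  congr
  exact ContinuousMap.ext ha

/-- Two arrows agree as soon as their sources, targets and restrictions to units agree. -/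
theorem ext_unit {L M : MapArr K G} (hd : L.dom = M.dom) (hc : L.cod = M.cod)
    (ha : ∀ x, L.app (K.unit x) = M.app (K.unit x)) : L = M := by
  refine ext' hd hc fun r => ?_
  rw [L.app_eq_right, M.app_eq_right]
  exact G.comp_congr (ha _) (by rw [hc]) _

/-- Build an arrow from its restriction `o` to units: a continuous natural transformation. -/
def ofUnits [K.IsTopological] [G.IsTopological] (dom cod : Hom K G) (o : K.Obj → G.Arr)
    (ho : Continuous o) (hs : ∀ x, G.src (o x) = dom.obj x) (ht : ∀ x, G.tgt (o x) = cod.obj x)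
    (nat : ∀ r, G.comp (dom.arr r) (o (K.tgt r)) (by rw [hs, dom.tgt_arr]) =
      G.comp (o (K.src r)) (cod.arr r) (by rw [ht, cod.src_arr])) : MapArr K G where
  dom := dom
  cod := cod
  app := ⟨fun r => G.comp (o (K.src r)) (cod.arr r) (by rw [ht, cod.src_arr]),
    G.continuous_comp_of (ho.comp IsTopological.continuous_src) cod.arr.continuous
      fun r => by simp [ht]⟩
  src_app r := by simp [hs]
  tgt_app r := by simp
  app_eq_left r := by
    simp only [ContinuousMap.coe_mk]
    rw [← nat r]
    refine G.comp_congr rfl ?_ _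
    rw [G.comp_congr (congrArg o (K.src_unit _)) (cod.arr_unit _)]
    exact (G.comp_unit_of _).symm
  app_eq_right r := by
    simp only [ContinuousMap.coe_mk]
    refine G.comp_congr ?_ rfl _
    rw [G.comp_congr (congrArg o (K.src_unit _)) (cod.arr_unit _)]
    exact (G.comp_unit_of _).symm

theorem ofUnits_app_unit [K.IsTopological] [G.IsTopological] (dom cod : Hom K G)
    (o : K.Obj → G.Arr) (ho : Continuous o) (hs ht nat) (x : K.Obj) :
    (ofUnits dom cod o ho hs ht nat).app (K.unit x) = o x := by
  change G.comp (o (K.src (K.unit x))) (cod.arr (K.unit x)) (by simp [ht]) = _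
  rw [G.comp_congr (congrArg o (K.src_unit _)) (cod.arr_unit _)]
  exact G.comp_unit_of _

theorem naturality (L : MapArr K G) (r : K.Arr) :
    G.comp (L.dom.arr r) (L.app (K.unit (K.tgt r))) (by simp) =
      G.comp (L.app (K.unit (K.src r))) (L.cod.arr r) (by simp) := by
  rw [← L.app_eq_left, ← L.app_eq_right]

/-- The unit arrow at `F`, that is `Λ = F₁`. -/
def one (F : Hom K G) : MapArr K G where
  dom := F
  cod := F
  app := F.arr
  src_app r := by simp
  tgt_app r := by simp
  app_eq_left r := by
    rw [G.comp_congr rfl (F.arr_unit _)]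
    exact (G.comp_unit_of _).symm
  app_eq_right r := by
    rw [G.comp_congr (F.arr_unit _) rfl]
    exact (G.unit_comp_of _).symm

/-- Pointwise composition: `(L · M)(r) = L(e s r) · M(e s r) · cod₁(r)`. -/
def mul [K.IsTopological] [G.IsTopological] (L M : MapArr K G) (h : L.cod = M.dom) :
    MapArr K G :=
  ofUnits L.dom M.cod
    (fun x => G.comp (L.app (K.unit x)) (M.app (K.unit x)) (by simp [h]))
    (G.continuous_comp_of (L.app.continuous.comp IsTopological.continuous_unit)
      (M.app.continuous.comp IsTopological.continuous_unit) fun x => by simp [h])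
    (fun x => by simp) (fun x => by simp)
    (fun r => by
      have hL := L.naturality r
      have hM := M.naturality r
      rw [← G.assoc _ _ _ (by simp) (by simp [h]), G.comp_congr hL rfl,
        G.assoc _ _ _ (by simp) (by simp [h])]
      rw [G.assoc _ _ _ (by simp [h]) (by simp)]
      refine G.comp_congr rfl ?_ _
      rw [← hM]
      exact G.comp_congr (by rw [h]) rfl _)

/-- Pointwise inverse. -/
def symm [K.IsTopological] [G.IsTopological] (L : MapArr K G) : MapArr K G :=
  ofUnits L.cod L.dom (fun x => G.inv (L.app (K.unit x)))
    (IsTopological.continuous_inv.comp (L.app.continuous.comp IsTopological.continuous_unit))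
    (fun x => by simp) (fun x => by simp)
    (fun r => by
      have hL := L.naturality r
      have h1 : G.comp (G.inv (L.app (K.unit (K.src r))))
          (G.comp (L.dom.arr r) (L.app (K.unit (K.tgt r))) (by simp)) (by simp) = L.cod.arr r := by
        rw [G.comp_congr rfl hL]
        exact G.inv_comp_cancel _ _
      rw [G.comp_congr h1.symm rfl, G.assoc _ _ _ (by simp) (by simp)]
      refine G.comp_congr rfl ?_ _
      rw [G.assoc _ _ _ (by simp) (by simp), G.comp_congr rfl (G.comp_inv _)]
      exact G.comp_unit_of _)

theorem mul_app_unit [K.IsTopological] [G.IsTopological] (L M : MapArr K G) (h : L.cod = M.dom)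
    (x : K.Obj) : (L.mul M h).app (K.unit x) =
      G.comp (L.app (K.unit x)) (M.app (K.unit x)) (by simp [h]) :=
  ofUnits_app_unit _ _ _ _ _ _ _ x

theorem symm_app_unit [K.IsTopological] [G.IsTopological] (L : MapArr K G) (x : K.Obj) :
    L.symm.app (K.unit x) = G.inv (L.app (K.unit x)) :=
  ofUnits_app_unit _ _ _ _ _ _ _ x

theorem one_app_unit (F : Hom K G) (x : K.Obj) : (one F).app (K.unit x) = G.unit (F.obj x) :=
  F.arr_unit x

theorem one_mul' [K.IsTopological] [G.IsTopological] (L : MapArr K G) (h) :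
    (one L.dom).mul L h = L := by
  refine ext_unit rfl rfl fun x => ?_
  rw [mul_app_unit, G.comp_congr (one_app_unit L.dom x) rfl]
  exact G.unit_comp_of _

theorem mul_one' [K.IsTopological] [G.IsTopological] (L : MapArr K G) (h) :
    L.mul (one L.cod) h = L := by
  refine ext_unit rfl rfl fun x => ?_
  rw [mul_app_unit, G.comp_congr rfl (one_app_unit L.cod x)]
  exact G.comp_unit_of _

theorem symm_mul [K.IsTopological] [G.IsTopological] (L : MapArr K G) (h) :
    L.symm.mul L h = one L.cod := by
  refine ext_unit rfl rfl fun x => ?_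
  rw [mul_app_unit, G.comp_congr (L.symm_app_unit x) rfl, G.inv_comp, one_app_unit, L.tgt_app,
    K.tgt_unit]

theorem mul_symm [K.IsTopological] [G.IsTopological] (L : MapArr K G) (h) :
    L.mul L.symm h = one L.dom := by
  refine ext_unit rfl rfl fun x => ?_
  rw [mul_app_unit, G.comp_congr rfl (L.symm_app_unit x), G.comp_inv, one_app_unit, L.src_app,
    K.src_unit]

theorem mul_assoc' [K.IsTopological] [G.IsTopological] (L M N : MapArr K G) (h h' h1 h2) :
    (L.mul M h).mul N h1 = L.mul (M.mul N h') h2 := by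
  refine ext_unit rfl rfl fun x => ?_
  refine (mul_app_unit _ _ _ x).trans (Eq.trans ?_ (mul_app_unit _ _ _ x).symm)
  refine (G.comp_congr (mul_app_unit L M h x) rfl _).trans ?_
  refine Eq.trans ?_ (G.comp_congr rfl (mul_app_unit M N h' x) _).symm
  exact G.assoc _ _ _ _ _

end MapArr

/-- The compact-open topology on morphisms `F = (F₀, F₁)`. -/
instance (K : TGpd.{v}) (G : TGpd.{u}) : TopologicalSpace (Hom K G) :=
  TopologicalSpace.induced (fun F => (F.obj, F.arr)) inferInstance

/-- The compact-open topology on arrows `Λ`, each of which is determined by the pair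
`(dom₁, Λ ∘ e)`. -/
instance (K : TGpd.{v}) (G : TGpd.{u}) [K.IsTopological] : TopologicalSpace (MapArr K G) :=
  TopologicalSpace.induced
    (fun L => (L.dom.arr, L.app.comp ⟨K.unit, IsTopological.continuous_unit⟩)) inferInstance

/-- The groupoid of morphisms `K → G` and arrows between them, with compact-open topologies. -/
def mapGpd (K : TGpd.{0}) (G : TGpd.{u}) [K.IsTopological] [G.IsTopological] : TGpd.{u} where
  Obj := Hom K G
  Arr := MapArr K G
  src := MapArr.dom
  tgt := MapArr.cod
  unit := MapArr.one
  inv := MapArr.symm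
  comp := MapArr.mul
  src_unit _ := rfl
  tgt_unit _ := rfl
  src_inv _ := rfl
  tgt_inv _ := rfl
  src_comp _ _ _ := rfl
  tgt_comp _ _ _ := rfl
  unit_comp L := L.one_mul' _
  comp_unit L := L.mul_one' _
  inv_comp L := L.symm_mul _
  comp_inv L := L.mul_symm _
  assoc L M N _ _ := L.mul_assoc' M N _ _ _ _

section Precomp

variable {K K' : TGpd.{0}} {G : TGpd.{u}}

/-- Precomposition of an arrow between morphisms with a morphism `E : K' → K`. -/
def MapArr.precomp (E : Hom K' K) (L : MapArr K G) : MapArr K' G where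
  dom := E.trans L.dom
  cod := E.trans L.cod
  app := L.app.comp E.arr
  src_app r := by simp [Hom.trans]
  tgt_app r := by simp [Hom.trans]
  app_eq_left r := by
    simp only [ContinuousMap.comp_apply]
    rw [L.app_eq_left]
    exact G.comp_congr rfl (by rw [E.arr_unit, E.tgt_arr]) _
  app_eq_right r := by
    simp only [ContinuousMap.comp_apply]
    rw [L.app_eq_right]
    exact G.comp_congr (by rw [E.arr_unit, E.src_arr]) rfl _

theorem Hom.continuous_pair (K : TGpd.{v}) (G : TGpd.{u}) :
    Continuous fun F : Hom K G => (F.obj, F.arr) :=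
  continuous_induced_dom

theorem MapArr.continuous_pair (K : TGpd.{v}) (G : TGpd.{u}) [K.IsTopological] :
    Continuous fun L : MapArr K G =>
      (L.dom.arr, L.app.comp ⟨K.unit, IsTopological.continuous_unit⟩) :=
  continuous_induced_dom

theorem Hom.continuous_trans (E : Hom K' K) :
    Continuous fun F : Hom K G => E.trans F := by
  refine continuous_induced_rng.2 (Continuous.prodMk ?_ ?_)
  · exact (ContinuousMap.continuous_precomp E.obj).comp
      (continuous_fst.comp (Hom.continuous_pair K G))
  · exact (ContinuousMap.continuous_precomp E.arr).comp
      (continuous_snd.comp (Hom.continuous_pair K G))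

theorem MapArr.continuous_precomp [K.IsTopological] [K'.IsTopological] (E : Hom K' K) :
    Continuous fun L : MapArr K G => L.precomp E := by
  refine continuous_induced_rng.2 (Continuous.prodMk ?_ ?_)
  · exact (ContinuousMap.continuous_precomp E.arr).comp
      (continuous_fst.comp (MapArr.continuous_pair K G))
  · have : ∀ L : MapArr K G, (L.precomp E).app.comp ⟨K'.unit, IsTopological.continuous_unit⟩ =
        (L.app.comp ⟨K.unit, IsTopological.continuous_unit⟩).comp E.obj := by
      intro L
      ext x
      simp [MapArr.precomp]
    simp only [this]
    exact (ContinuousMap.continuous_precomp E.obj).comp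
      (continuous_snd.comp (MapArr.continuous_pair K G))

theorem MapArr.precomp_mul [K.IsTopological] [K'.IsTopological] [G.IsTopological] (E : Hom K' K)
    (L M : MapArr K G) (h) (h') : (L.mul M h).precomp E = (L.precomp E).mul (M.precomp E) h' := by
  refine MapArr.ext_unit rfl rfl fun x => ?_
  rw [MapArr.mul_app_unit]
  change (L.mul M h).app (E.arr (K'.unit x)) = _
  rw [E.arr_unit, MapArr.mul_app_unit]
  exact G.comp_congr (congrArg L.app (E.arr_unit x).symm) (congrArg M.app (E.arr_unit x).symm) _

/-- A morphism `E : K' → K` induces a morphism of mapping groupoids by precomposition. -/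
def precomp [K.IsTopological] [K'.IsTopological] (E : Hom K' K) (G : TGpd.{u})
    [G.IsTopological] : Hom (mapGpd K G) (mapGpd K' G) where
  obj := ⟨fun F : Hom K G => E.trans F, Hom.continuous_trans E⟩
  arr := ⟨fun L : MapArr K G => L.precomp E, MapArr.continuous_precomp E⟩
  src_arr _ := rfl
  tgt_arr _ := rfl
  arr_unit _ := rfl
  arr_comp L M h := MapArr.precomp_mul E L M h (congrArg E.trans h)

end Precomp

/-! ### Colimits of directed systems of groupoids -/

/-- A functor from a preorder to groupoids with topologies. -/
structure DirSystem (I : Type) [Preorder I] where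
  gpd : I → TGpd.{u}
  map : ∀ i j, i ≤ j → Hom (gpd i) (gpd j)
  obj_self : ∀ i x, (map i i le_rfl).obj x = x
  arr_self : ∀ i a, (map i i le_rfl).arr a = a
  obj_map : ∀ i j k (hij : i ≤ j) (hjk : j ≤ k) x,
    (map j k hjk).obj ((map i j hij).obj x) = (map i k (hij.trans hjk)).obj x
  arr_map : ∀ i j k (hij : i ≤ j) (hjk : j ≤ k) a,
    (map j k hjk).arr ((map i j hij).arr a) = (map i k (hij.trans hjk)).arr a

namespace DirSystem

variable {I : Type} [Preorder I] (S : DirSystem.{u} I)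

instance : DirectedSystem (fun i => (S.gpd i).Obj) (fun i j h => (S.map i j h).obj) where
  map_self _ x := S.obj_self _ x
  map_map _ _ _ hij hjk x := S.obj_map _ _ _ hij hjk x

instance : DirectedSystem (fun i => (S.gpd i).Arr) (fun i j h => (S.map i j h).arr) where
  map_self _ x := S.arr_self _ x
  map_map _ _ _ hij hjk x := S.arr_map _ _ _ hij hjk x

variable [IsDirectedOrder I]

/-- The space of objects of the colimit: the colimit of the spaces of objects (its topology is the
quotient topology of the disjoint union). -/
abbrev ColimObj : Type u :=
  DirectLimit (fun i => (S.gpd i).Obj) (fun i j h => (S.map i j h).obj)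

/-- The space of arrows of the colimit: the colimit of the spaces of arrows. -/
abbrev ColimArr : Type u :=
  DirectLimit (fun i => (S.gpd i).Arr) (fun i j h => (S.map i j h).arr)

/-- The class in the colimit of an object of one of the groupoids of the system. -/
abbrev mkObj (i : I) (x : (S.gpd i).Obj) : S.ColimObj := Quotient.mk _ ⟨i, x⟩

/-- The class in the colimit of an arrow of one of the groupoids of the system. -/
abbrev mkArr (i : I) (a : (S.gpd i).Arr) : S.ColimArr := Quotient.mk _ ⟨i, a⟩

theorem mkObj_map (i j : I) (h : i ≤ j) (x : (S.gpd i).Obj) :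
    S.mkObj j ((S.map i j h).obj x) = S.mkObj i x :=
  DirectLimit.mk_apply (F := fun i => (S.gpd i).Obj) (f := fun i j h => (S.map i j h).obj) i j x h

theorem mkArr_map (i j : I) (h : i ≤ j) (a : (S.gpd i).Arr) :
    S.mkArr j ((S.map i j h).arr a) = S.mkArr i a :=
  DirectLimit.mk_apply (F := fun i => (S.gpd i).Arr) (f := fun i j h => (S.map i j h).arr) i j a h

theorem mkObj_eq_iff {i j : I} {x : (S.gpd i).Obj} {y : (S.gpd j).Obj} :
    S.mkObj i x = S.mkObj j y ↔
      ∃ (k : I) (hi : i ≤ k) (hj : j ≤ k), (S.map i k hi).obj x = (S.map j k hj).obj y :=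
  Quotient.eq

theorem mkArr_eq_iff {i j : I} {x : (S.gpd i).Arr} {y : (S.gpd j).Arr} :
    S.mkArr i x = S.mkArr j y ↔
      ∃ (k : I) (hi : i ≤ k) (hj : j ≤ k), (S.map i k hi).arr x = (S.map j k hj).arr y :=
  Quotient.eq

/-- Source map of the colimit. -/
def colimSrc : S.ColimArr → S.ColimObj :=
  DirectLimit.map _ _ (fun i => (S.gpd i).src) fun i j h a => ((S.map i j h).src_arr a).symm

/-- Target map of the colimit. -/
def colimTgt : S.ColimArr → S.ColimObj :=
  DirectLimit.map _ _ (fun i => (S.gpd i).tgt) fun i j h a => ((S.map i j h).tgt_arr a).symm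

theorem colimSrc_mk {i : I} (a : (S.gpd i).Arr) :
    S.colimSrc (S.mkArr i a) = S.mkObj i ((S.gpd i).src a) := rfl

theorem colimTgt_mk {i : I} (a : (S.gpd i).Arr) :
    S.colimTgt (S.mkArr i a) = S.mkObj i ((S.gpd i).tgt a) := rfl

/-- Unit map of the colimit. -/
def colimUnit : S.ColimObj → S.ColimArr :=
  DirectLimit.map _ _ (fun i => (S.gpd i).unit) fun i j h x => (S.map i j h).arr_unit x

/-- Inversion of the colimit. -/
def colimInv : S.ColimArr → S.ColimArr :=
  DirectLimit.map _ _ (fun i => (S.gpd i).inv) fun i j h a => (S.map i j h).arr_inv a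

/-- Composable arrows of the colimit are represented by composable arrows at some stage. -/
theorem exists_composable (a b : S.ColimArr) (h : S.colimTgt a = S.colimSrc b) :
    ∃ p : Σ i, {p : (S.gpd i).Arr × (S.gpd i).Arr // (S.gpd i).tgt p.1 = (S.gpd i).src p.2},
      S.mkArr p.1 p.2.1.1 = a ∧ S.mkArr p.1 p.2.1.2 = b := by
  obtain ⟨i, x, y, rfl, rfl⟩ := DirectLimit.exists_eq_mk₂ _ a b
  obtain ⟨k, hi, hj, e⟩ := S.mkObj_eq_iff.1 h
  refine ⟨⟨k, ⟨((S.map i k hi).arr x, (S.map i k hi).arr y), ?_⟩⟩, S.mkArr_map _ _ _ _,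
    S.mkArr_map _ _ _ _⟩
  rw [Hom.tgt_arr, Hom.src_arr]
  exact e

/-- Composition in the colimit: compose representatives at some stage. -/
noncomputable def colimComp (a b : S.ColimArr) (h : S.colimTgt a = S.colimSrc b) : S.ColimArr :=
  let p := (S.exists_composable a b h).choose
  S.mkArr p.1 ((S.gpd p.1).comp p.2.1.1 p.2.1.2 p.2.2)

theorem mkArr_comp_congr {i j : I} {a b : (S.gpd i).Arr} {a' b' : (S.gpd j).Arr}
    (h : (S.gpd i).tgt a = (S.gpd i).src b) (h' : (S.gpd j).tgt a' = (S.gpd j).src b')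
    (ha : S.mkArr i a = S.mkArr j a') (hb : S.mkArr i b = S.mkArr j b') :
    S.mkArr i ((S.gpd i).comp a b h) = S.mkArr j ((S.gpd j).comp a' b' h') := by
  obtain ⟨k, hi, hj, e⟩ := S.mkArr_eq_iff.1 ha
  obtain ⟨l, hi', hj', e'⟩ := S.mkArr_eq_iff.1 hb
  obtain ⟨m, hk, hl⟩ := exists_ge_ge k l
  refine S.mkArr_eq_iff.2 ⟨m, hi.trans hk, hj.trans hk, ?_⟩
  rw [Hom.arr_comp, Hom.arr_comp]
  refine TGpd.comp_congr _ ?_ ?_ _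
  · rw [← S.arr_map i k m hi hk, ← S.arr_map j k m hj hk, e]
  · rw [← S.arr_map i l m hi' hl, ← S.arr_map j l m hj' hl, e']

/-- The composition of the colimit is computed by any composable representatives. -/
theorem colimComp_mk {i : I} (a b : (S.gpd i).Arr) (h : (S.gpd i).tgt a = (S.gpd i).src b)
    (h' : S.colimTgt (S.mkArr i a) = S.colimSrc (S.mkArr i b)) :
    S.colimComp (S.mkArr i a) (S.mkArr i b) h' = S.mkArr i ((S.gpd i).comp a b h) :=
  S.mkArr_comp_congr _ _ (S.exists_composable _ _ h').choose_spec.1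
    (S.exists_composable _ _ h').choose_spec.2

theorem colimComp_exists (a b : S.ColimArr) (h : S.colimTgt a = S.colimSrc b) :
    ∃ (i : I) (x y : (S.gpd i).Arr) (e : (S.gpd i).tgt x = (S.gpd i).src y),
      S.mkArr i x = a ∧ S.mkArr i y = b ∧
        S.colimComp a b h = S.mkArr i ((S.gpd i).comp x y e) :=
  ⟨_, _, _, (S.exists_composable a b h).choose.2.2, (S.exists_composable a b h).choose_spec.1,
    (S.exists_composable a b h).choose_spec.2, rfl⟩

/-- The colimit of a directed system of groupoids: objects and arrows are the colimits of the
spaces of objects and of arrows. -/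
noncomputable def colimit : TGpd.{u} where
  Obj := S.ColimObj
  Arr := S.ColimArr
  src := S.colimSrc
  tgt := S.colimTgt
  unit := S.colimUnit
  inv := S.colimInv
  comp := S.colimComp
  src_unit := by
    rintro ⟨i, x⟩
    exact congrArg (S.mkObj i) ((S.gpd i).src_unit x)
  tgt_unit := by
    rintro ⟨i, x⟩
    exact congrArg (S.mkObj i) ((S.gpd i).tgt_unit x)
  src_inv := by
    rintro ⟨i, x⟩
    exact congrArg (S.mkObj i) ((S.gpd i).src_inv x)
  tgt_inv := by
    rintro ⟨i, x⟩
    exact congrArg (S.mkObj i) ((S.gpd i).tgt_inv x)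
  src_comp a b h := by
    obtain ⟨i, x, y, e, rfl, rfl, hc⟩ := S.colimComp_exists a b h
    rw [hc]
    exact congrArg (S.mkObj i) ((S.gpd i).src_comp x y e)
  tgt_comp a b h := by
    obtain ⟨i, x, y, e, rfl, rfl, hc⟩ := S.colimComp_exists a b h
    rw [hc]
    exact congrArg (S.mkObj i) ((S.gpd i).tgt_comp x y e)
  unit_comp := by
    rintro ⟨i, x⟩
    exact (S.colimComp_mk _ x ((S.gpd i).tgt_unit _) _).trans
      (congrArg (S.mkArr i) ((S.gpd i).unit_comp x))
  comp_unit := by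
    rintro ⟨i, x⟩
    exact (S.colimComp_mk x _ ((S.gpd i).src_unit _).symm _).trans
      (congrArg (S.mkArr i) ((S.gpd i).comp_unit x))
  inv_comp := by
    rintro ⟨i, x⟩
    exact (S.colimComp_mk _ x ((S.gpd i).tgt_inv _) _).trans
      (congrArg (S.mkArr i) ((S.gpd i).inv_comp x))
  comp_inv := by
    rintro ⟨i, x⟩
    exact (S.colimComp_mk x _ ((S.gpd i).src_inv _).symm _).trans
      (congrArg (S.mkArr i) ((S.gpd i).comp_inv x))
  assoc a b c hab hbc := by
    obtain ⟨i, x, y, z, rfl, rfl, rfl⟩ := DirectLimit.exists_eq_mk₃ _ a b c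
    obtain ⟨k, hk, _, e⟩ := S.mkObj_eq_iff.1 hab
    obtain ⟨l, hl, _, e'⟩ := S.mkObj_eq_iff.1 hbc
    obtain ⟨m, hkm, hlm⟩ := exists_ge_ge k l
    have key : ∀ (x' y' z' : (S.gpd m).Arr) (a b c : S.ColimArr) (_ : S.mkArr m x' = a)
        (_ : S.mkArr m y' = b) (_ : S.mkArr m z' = c) (_ : (S.gpd m).tgt x' = (S.gpd m).src y')
        (_ : (S.gpd m).tgt y' = (S.gpd m).src z') (h1 h2 h3 h4),
        S.colimComp (S.colimComp a b h1) c h2 = S.colimComp a (S.colimComp b c h3) h4 := by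
      rintro x' y' z' _ _ _ rfl rfl rfl hx hy h1 h2 h3 h4
      have e1 := S.colimComp_mk x' y' hx h1
      have e2 := S.colimComp_mk y' z' hy h3
      calc S.colimComp (S.colimComp _ _ h1) _ h2
          = S.colimComp (S.mkArr m ((S.gpd m).comp x' y' hx)) (S.mkArr m z') (e1 ▸ h2) := by
            simp only [e1]
        _ = S.mkArr m ((S.gpd m).comp ((S.gpd m).comp x' y' hx) z' (by simp [hy])) :=
            S.colimComp_mk _ _ _ _
        _ = S.mkArr m ((S.gpd m).comp x' ((S.gpd m).comp y' z' hy) (by simp [hx])) :=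
            congrArg _ ((S.gpd m).assoc _ _ _ _ _)
        _ = S.colimComp (S.mkArr m x') (S.mkArr m ((S.gpd m).comp y' z' hy)) (e2 ▸ h4) :=
            (S.colimComp_mk _ _ _ _).symm
        _ = S.colimComp _ (S.colimComp _ _ h3) h4 := by simp only [e2]
    refine key ((S.map i m (hk.trans hkm)).arr x) ((S.map i m (hk.trans hkm)).arr y)
      ((S.map i m (hk.trans hkm)).arr z) _ _ _ (S.mkArr_map _ _ _ _) (S.mkArr_map _ _ _ _)
      (S.mkArr_map _ _ _ _) ?_ ?_ _ _ _ _
    · rw [Hom.tgt_arr, Hom.src_arr, ← S.obj_map i k m hk hkm, ← S.obj_map i k m hk hkm]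
      exact congrArg _ e
    · rw [Hom.tgt_arr, Hom.src_arr, ← S.obj_map i l m hl hlm, ← S.obj_map i l m hl hlm]
      exact congrArg _ e'

/-- The canonical morphism from one of the groupoids of the system to the colimit. -/
noncomputable def ι (i : I) : Hom (S.gpd i) S.colimit where
  obj := ⟨fun x => S.mkObj i x, continuous_quotient_mk'.comp continuous_sigmaMk⟩
  arr := ⟨fun a => S.mkArr i a, continuous_quotient_mk'.comp continuous_sigmaMk⟩
  src_arr _ := rfl
  tgt_arr _ := rfl
  arr_unit _ := rfl
  arr_comp a b h := (S.colimComp_mk a b h ((S.colimTgt_mk a).trans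
    ((congrArg (S.mkObj i) h).trans (S.colimSrc_mk b).symm))).symm

/-- The morphism out of the colimit induced by a compatible family of morphisms. -/
noncomputable def desc {H : TGpd.{u}} (F : ∀ i, Hom (S.gpd i) H)
    (hobj : ∀ i j h x, (F i).obj x = (F j).obj ((S.map i j h).obj x))
    (harr : ∀ i j h a, (F i).arr a = (F j).arr ((S.map i j h).arr a)) : Hom S.colimit H where
  obj := ⟨DirectLimit.lift _ (fun i x => (F i).obj x) hobj,
    continuous_coinduced_dom.2 (continuous_sigma fun i => (F i).obj.continuous)⟩
  arr := ⟨DirectLimit.lift _ (fun i a => (F i).arr a) harr,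
    continuous_coinduced_dom.2 (continuous_sigma fun i => (F i).arr.continuous)⟩
  src_arr := by
    rintro ⟨i, a⟩
    exact (F i).src_arr a
  tgt_arr := by
    rintro ⟨i, a⟩
    exact (F i).tgt_arr a
  arr_unit := by
    rintro ⟨i, a⟩
    exact (F i).arr_unit a
  arr_comp a b h := by
    obtain ⟨i, x, y, e, rfl, rfl, hc⟩ := S.colimComp_exists a b h
    exact (congrArg (DirectLimit.lift _ (fun i a => (F i).arr a) harr) hc).trans
      ((F i).arr_comp x y e)

end DirSystem

/-- The subgroupoid, with the subspace topologies, of the objects and arrows that are fixed by all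
members of a family of endomorphisms. -/
def fixedGpd (G : TGpd.{u}) {Z : Type*} (T : Z → Hom G G) : TGpd.{u} where
  Obj := {x : G.Obj // ∀ z, (T z).obj x = x}
  Arr := {a : G.Arr // ∀ z, (T z).arr a = a}
  src a := ⟨G.src a.1, fun z => by rw [← (T z).src_arr, a.2 z]⟩
  tgt a := ⟨G.tgt a.1, fun z => by rw [← (T z).tgt_arr, a.2 z]⟩
  unit x := ⟨G.unit x.1, fun z => by rw [(T z).arr_unit, x.2 z]⟩
  inv a := ⟨G.inv a.1, fun z => by rw [(T z).arr_inv, a.2 z]⟩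
  comp a b h := ⟨G.comp a.1 b.1 (congrArg Subtype.val h), fun z => by
    rw [(T z).arr_comp]
    exact G.comp_congr (a.2 z) (b.2 z) _⟩
  src_unit x := Subtype.ext (G.src_unit _)
  tgt_unit x := Subtype.ext (G.tgt_unit _)
  src_inv x := Subtype.ext (G.src_inv _)
  tgt_inv x := Subtype.ext (G.tgt_inv _)
  src_comp a b h := Subtype.ext (G.src_comp _ _ _)
  tgt_comp a b h := Subtype.ext (G.tgt_comp _ _ _)
  unit_comp a := Subtype.ext (G.unit_comp _)
  comp_unit a := Subtype.ext (G.comp_unit _)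
  inv_comp a := Subtype.ext (G.inv_comp _)
  comp_inv a := Subtype.ext (G.comp_inv _)
  assoc a b c hab hbc := Subtype.ext (G.assoc _ _ _ _ _)

/-! ### Admissible covers of the circle and the groupoids of the circle -/

end TGpd

/-- For a finite set `P` of points of the circle `ℝ / ℤ` and a lift `a ∈ ℝ` of one of them, the
interval `(a - ε, a⁺ + ε)`, where `a⁺` is the next lift of a point of `P` after `a`; see
`CircleCover.interval_eq_Ioo`. -/
def coverInterval (P : Set UnitAddCircle) (ε a : ℝ) : Set ℝ :=
  {x | a - ε < x ∧ ∀ b : ℝ, (b : UnitAddCircle) ∈ P → a < b → x < b + ε}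

/-- The data of an admissible cover of the circle `ℝ / ℤ`: a nonempty finite set of points and
`ε > 0`. The pulled back cover of `ℝ` consists of the intervals `(a - ε, a⁺ + ε)`, where `a` runs
through the lifts of the points and `a⁺` is the next lift after `a`; the cover is admissible if
triple intersections of these intervals are empty. -/
structure CircleCover where
  pts : Set UnitAddCircle
  finite : pts.Finite
  nonempty : pts.Nonempty
  ε : ℝ
  ε_pos : 0 < ε
  admissible : ∀ a b c : ℝ, (a : UnitAddCircle) ∈ pts → (b : UnitAddCircle) ∈ pts →
    (c : UnitAddCircle) ∈ pts → a < b → b < c →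
    coverInterval pts ε a ∩ coverInterval pts ε b ∩ coverInterval pts ε c = ∅

namespace CircleCover

/-- The index set of the pulled back cover of `ℝ`: the lifts to `ℝ` of the chosen points. It is
regarded as a discrete set. -/
@[ext]
structure Index (W : CircleCover) where
  val : ℝ
  mem : (val : UnitAddCircle) ∈ W.pts

instance (W : CircleCover) : TopologicalSpace W.Index := ⊥

instance (W : CircleCover) : DiscreteTopology W.Index := ⟨rfl⟩

/-- The interval `(a - ε, a⁺ + ε)` of the pulled back cover. -/
def interval (W : CircleCover) (a : W.Index) : Set ℝ := coverInterval W.pts W.ε a.val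

theorem interval_eq_Ioo (W : CircleCover) (a b : W.Index) (hab : a.val < b.val)
    (hb : ∀ c : W.Index, a.val < c.val → b.val ≤ c.val) :
    W.interval a = Set.Ioo (a.val - W.ε) (b.val + W.ε) := by
  ext x
  refine ⟨fun h => ⟨h.1, h.2 b.val b.mem hab⟩,
    fun h => ⟨h.1, fun c hc hac => h.2.trans_le ?_⟩⟩
  have := hb ⟨c, hc⟩ hac
  simp only at this
  linarith

/-- Translation of an index by an integer. -/
def Index.shift {W : CircleCover} (a : W.Index) (l : ℤ) : W.Index where
  val := a.val + l
  mem := by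
    have h : ((l : ℝ) : UnitAddCircle) = 0 :=
      (AddCircle.coe_eq_zero_iff (p := (1 : ℝ))).2 ⟨l, by simp⟩
    rw [AddCircle.coe_add, h, add_zero]
    exact a.mem

@[simp]
theorem Index.shift_val {W : CircleCover} (a : W.Index) (l : ℤ) :
    (a.shift l).val = a.val + l := rfl

@[simp]
theorem Index.shift_shift {W : CircleCover} (a : W.Index) (l k : ℤ) :
    (a.shift l).shift k = a.shift (l + k) := by
  ext; simp [add_assoc]

@[simp]
theorem Index.shift_zero {W : CircleCover} (a : W.Index) : a.shift 0 = a := by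
  ext; simp

theorem mem_interval_shift {W : CircleCover} {a : W.Index} {x : ℝ} (l : ℤ)
    (h : x ∈ W.interval a) : x + l ∈ W.interval (a.shift l) := by
  refine ⟨?_, fun b hbm hb => ?_⟩
  · have := h.1
    simp only [Index.shift_val]
    linarith
  · have := h.2 _ (Index.shift ⟨b, hbm⟩ (-l) : W.Index).mem (by simp at hb ⊢; linarith)
    simp at this
    linarith

/-- `W'` refines `W` (written `W ≤ W'`) if it has more points and a smaller `ε`. -/
instance : Preorder CircleCover where
  le W W' := W.pts ⊆ W'.pts ∧ W'.ε ≤ W.ε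
  le_refl W := ⟨subset_rfl, le_rfl⟩
  le_trans _ _ _ h h' := ⟨h.1.trans h'.1, h'.2.trans h.2⟩

/-- For every real number there is a greatest lift below it. -/
theorem exists_floor (W : CircleCover) (x : ℝ) :
    ∃ a : W.Index, a.val ≤ x ∧ ∀ b : W.Index, b.val ≤ x → b.val ≤ a.val := by
  obtain ⟨q, hq, hmax⟩ := Set.exists_max_image W.pts
    (fun q => ((AddCircle.equivIoc (1 : ℝ) (x - 1) q : Set.Ioc (x - 1) (x - 1 + 1)) : ℝ))
    W.finite W.nonempty
  have hcoe : ∀ q : UnitAddCircle,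
      (((AddCircle.equivIoc (1 : ℝ) (x - 1) q : Set.Ioc (x - 1) (x - 1 + 1)) : ℝ) :
        UnitAddCircle) = q := fun q => (AddCircle.equivIoc (1 : ℝ) (x - 1)).symm_apply_apply q
  refine ⟨⟨_, by rw [hcoe q]; exact hq⟩, ?_, fun b hb => ?_⟩
  · have := (AddCircle.equivIoc (1 : ℝ) (x - 1) q).2.2
    simp only
    linarith
  · rcases le_or_gt b.val (x - 1) with h | h
    · exact h.trans (AddCircle.equivIoc (1 : ℝ) (x - 1) q).2.1.le
    · have h1 := hmax _ b.mem
      have h2 : ((AddCircle.equivIoc (1 : ℝ) (x - 1) (b.val : UnitAddCircle) :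
          Set.Ioc (x - 1) (x - 1 + 1)) : ℝ) = b.val := by
        have := (AddCircle.equivIoc (1 : ℝ) (x - 1)).apply_symm_apply
          ⟨b.val, h, by linarith⟩
        exact congrArg Subtype.val this
      rw [h2] at h1
      exact h1

/-- The greatest lift below a real number. -/
noncomputable def floor (W : CircleCover) (x : ℝ) : W.Index := (W.exists_floor x).choose

theorem floor_le (W : CircleCover) (x : ℝ) : (W.floor x).val ≤ x :=
  (W.exists_floor x).choose_spec.1

theorem le_floor (W : CircleCover) {x : ℝ} {b : W.Index} (h : b.val ≤ x) :
    b.val ≤ (W.floor x).val :=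
  (W.exists_floor x).choose_spec.2 b h

theorem floor_eq (W : CircleCover) {x : ℝ} {a : W.Index} (h : a.val ≤ x)
    (h' : ∀ b : W.Index, b.val ≤ x → b.val ≤ a.val) : W.floor x = a :=
  Index.ext (le_antisymm (h' _ (W.floor_le x)) (W.le_floor h))

theorem floor_val (W : CircleCover) (a : W.Index) : W.floor a.val = a :=
  W.floor_eq le_rfl fun _ h => h

theorem floor_add_int (W : CircleCover) (x : ℝ) (l : ℤ) :
    W.floor (x + l) = (W.floor x).shift l := by
  refine W.floor_eq (by simpa using W.floor_le x) fun b hb => ?_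
  have := W.le_floor (x := x) (b := b.shift (-l)) (by simp; linarith)
  simp at this ⊢
  linarith

theorem floor_floor {W W' : CircleCover} (h : W ≤ W') (x : ℝ) :
    W.floor (W'.floor x).val = W.floor x :=
  W.floor_eq ((W.floor_le _).trans (W'.floor_le _)) (fun b hb => by
    refine W.le_floor ?_
    exact W'.le_floor (b := ⟨b.val, h.1 b.mem⟩) hb) |>.symm

/-- Each interval of the finer cover is contained in the interval of the coarser one whose left
point is the nearest one to the left. -/
theorem mem_interval_floor {W W' : CircleCover} (h : W ≤ W') {a : W'.Index} {x : ℝ}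
    (hx : x ∈ W'.interval a) : x ∈ W.interval (W.floor a.val) := by
  have hε := h.2
  refine ⟨?_, fun b hbm hb => ?_⟩
  · have := W.floor_le a.val
    have := hx.1
    linarith
  · have hab : a.val < b := by
      by_contra hcon
      exact absurd (W.le_floor (b := ⟨b, hbm⟩) (not_lt.1 hcon)) (not_le.2 hb)
    have := hx.2 b (h.1 hbm) hab
    linarith

/-- Any two admissible covers have a common admissible refinement. -/
instance : IsDirectedOrder CircleCover where
  directed W W' := by
    have hfin : (W.pts ∪ W'.pts).Finite := W.finite.union W'.finite
    obtain ⟨δ, hδ, hδ1, hsep⟩ : ∃ δ : ℝ, 0 < δ ∧ δ ≤ 1 ∧ ∀ p ∈ W.pts ∪ W'.pts,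
        ∀ q ∈ W.pts ∪ W'.pts, p ≠ q → δ ≤ ‖p - q‖ := by
      have hD : ((fun r : UnitAddCircle × UnitAddCircle => ‖r.1 - r.2‖) ''
          (((W.pts ∪ W'.pts) ×ˢ (W.pts ∪ W'.pts)) ∩ {r | r.1 ≠ r.2})).Finite :=
        ((hfin.prod hfin).subset Set.inter_subset_left).image _
      obtain ⟨m, hm, hmin⟩ := Set.exists_min_image _ id (hD.insert 1) ⟨1, Set.mem_insert _ _⟩
      refine ⟨m, ?_, hmin 1 (Set.mem_insert _ _), fun p hp q hq hpq =>
        hmin _ (Set.mem_insert_of_mem _ ⟨(p, q), ⟨⟨hp, hq⟩, hpq⟩, rfl⟩)⟩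
      rcases hm with rfl | ⟨r, hr, rfl⟩
      · exact one_pos
      · exact norm_pos_iff.2 (sub_ne_zero.2 hr.2)
    have hgap : ∀ a b : ℝ, (a : UnitAddCircle) ∈ W.pts ∪ W'.pts →
        (b : UnitAddCircle) ∈ W.pts ∪ W'.pts → a < b → δ ≤ b - a := by
      intro a b ha hb hab
      by_cases hne : (b : UnitAddCircle) = a
      · have h0 : ((b - a : ℝ) : UnitAddCircle) = 0 := by rw [AddCircle.coe_sub, hne, sub_self]
        obtain ⟨n, hn⟩ := (AddCircle.coe_eq_zero_iff (p := (1 : ℝ))).1 h0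
        have hn' : (n : ℝ) = b - a := by simpa using hn
        have hpos : (0 : ℝ) < n := by linarith
        have : (1 : ℝ) ≤ n := by exact_mod_cast (Int.cast_pos.1 hpos : 0 < n)
        linarith
      · have h1 := hsep _ hb _ ha hne
        have h2 : ‖((b - a : ℝ) : UnitAddCircle)‖ ≤ |b - a| := by
          rw [← Real.norm_eq_abs]
          exact QuotientAddGroup.norm_mk_le_norm
        rw [AddCircle.coe_sub, abs_of_pos (by linarith)] at h2
        linarith
    refine ⟨⟨W.pts ∪ W'.pts, hfin, W.nonempty.inl, min (min W.ε W'.ε) (δ / 2), ?_, ?_⟩, ?_, ?_⟩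
    · exact lt_min (lt_min W.ε_pos W'.ε_pos) (half_pos hδ)
    · intro a b c ha hb hc hab hbc
      refine Set.eq_empty_of_forall_notMem fun x hx => ?_
      have h1 := hx.2.1
      have h2 := hx.1.1.2 b hb hab
      have h3 := hgap b c hb hc hbc
      have h4 := min_le_right (min W.ε W'.ε) (δ / 2)
      linarith
    · exact ⟨Set.subset_union_left, (min_le_left _ _).trans (min_le_left _ _)⟩
    · exact ⟨Set.subset_union_right, (min_le_left _ _).trans (min_le_right _ _)⟩

/-- The groupoid of the circle attached to a cover. Its objects are the pairs `(x, a)` with `x` in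
the interval `W_a`, i.e. the disjoint union of the intervals; its arrows are the `((x, a, b), l)`
with `x ∈ W_a ∩ W_b` and `l ∈ ℤ`, from `(x, a)` to `(x + l, b + l)`. -/
def circle (W : CircleCover) : TGpd.{0} where
  Obj := {p : ℝ × W.Index // p.1 ∈ W.interval p.2}
  Arr := {r : (ℝ × W.Index × W.Index) × ℤ //
    r.1.1 ∈ W.interval r.1.2.1 ∧ r.1.1 ∈ W.interval r.1.2.2}
  src r := ⟨(r.1.1.1, r.1.1.2.1), r.2.1⟩
  tgt r := ⟨(r.1.1.1 + r.1.2, r.1.1.2.2.shift r.1.2), mem_interval_shift _ r.2.2⟩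
  unit p := ⟨((p.1.1, p.1.2, p.1.2), 0), p.2, p.2⟩
  inv r := ⟨((r.1.1.1 + r.1.2, r.1.1.2.2.shift r.1.2, r.1.1.2.1.shift r.1.2), -r.1.2),
    mem_interval_shift _ r.2.2, mem_interval_shift _ r.2.1⟩
  comp r r' h := ⟨((r.1.1.1, r.1.1.2.1, r'.1.1.2.2.shift (-r.1.2)), r.1.2 + r'.1.2), r.2.1, by
    have h1 : r.1.1.1 + r.1.2 = r'.1.1.1 := congrArg (fun p => p.1.1) h
    have h2 := mem_interval_shift (-r.1.2) r'.2.2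
    rw [← h1] at h2
    simpa using h2⟩
  src_unit p := rfl
  tgt_unit p := by simp
  src_inv r := rfl
  tgt_inv r := by simp
  src_comp r r' h := rfl
  tgt_comp r r' h := by
    have h1 : r.1.1.1 + r.1.2 = r'.1.1.1 := congrArg (fun p => p.1.1) h
    refine Subtype.ext (Prod.ext ?_ ?_)
    · simp [← h1, add_assoc]
    · simp
  unit_comp r := by simp
  comp_unit r := by simp
  inv_comp r := by simp
  comp_inv r := by simp
  assoc r r' r'' h h' := by simp [add_comm, add_left_comm]

theorem continuous_shift (W : CircleCover) :
    Continuous fun p : W.Index × ℤ => p.1.shift p.2 :=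
  continuous_of_discreteTopology

theorem continuous_translate : Continuous fun p : ℝ × ℤ => p.1 + (p.2 : ℝ) :=
  continuous_fst.add ((continuous_of_discreteTopology (f := fun n : ℤ => (n : ℝ))).comp
    continuous_snd)

instance (W : CircleCover) : W.circle.IsTopological where
  continuous_src := by
    refine Continuous.subtype_mk ?_ _
    fun_prop
  continuous_tgt := by
    refine Continuous.subtype_mk (Continuous.prodMk ?_ ?_) _
    · exact continuous_translate.comp
        (by fun_prop : Continuous fun r : W.circle.Arr => (r.1.1.1, r.1.2))
    · exact W.continuous_shift.comp
        (by fun_prop : Continuous fun r : W.circle.Arr => (r.1.1.2.2, r.1.2))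
  continuous_unit := by
    refine Continuous.subtype_mk ?_ _
    fun_prop
  continuous_inv := by
    refine Continuous.subtype_mk (Continuous.prodMk (Continuous.prodMk ?_
      (Continuous.prodMk ?_ ?_)) ?_) _
    · exact continuous_translate.comp
        (by fun_prop : Continuous fun r : W.circle.Arr => (r.1.1.1, r.1.2))
    · exact W.continuous_shift.comp
        (by fun_prop : Continuous fun r : W.circle.Arr => (r.1.1.2.2, r.1.2))
    · exact W.continuous_shift.comp
        (by fun_prop : Continuous fun r : W.circle.Arr => (r.1.1.2.1, r.1.2))
    · fun_prop
  continuous_comp := by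
    have h1 : Continuous fun p : {p : W.circle.Arr × W.circle.Arr //
        W.circle.tgt p.1 = W.circle.src p.2} => p.1.1.1 :=
      continuous_subtype_val.comp (continuous_fst.comp continuous_subtype_val)
    have h2 : Continuous fun p : {p : W.circle.Arr × W.circle.Arr //
        W.circle.tgt p.1 = W.circle.src p.2} => p.1.2.1 :=
      continuous_subtype_val.comp (continuous_snd.comp continuous_subtype_val)
    refine Continuous.subtype_mk (Continuous.prodMk (Continuous.prodMk ?_
      (Continuous.prodMk ?_ ?_)) ?_) _
    · exact continuous_fst.comp (continuous_fst.comp h1)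
    · exact continuous_fst.comp (continuous_snd.comp (continuous_fst.comp h1))
    · exact W.continuous_shift.comp ((continuous_snd.comp (continuous_snd.comp
        (continuous_fst.comp h2))).prodMk (continuous_snd.comp h1).neg)
    · exact (continuous_snd.comp h1).add (continuous_snd.comp h2)

/-- The natural morphism from the groupoid of a finer cover to that of a coarser one. -/
noncomputable def refineHom {W W' : CircleCover} (h : W ≤ W') : W'.circle.Hom W.circle where
  obj := ⟨fun p => ⟨(p.1.1, W.floor p.1.2.val), mem_interval_floor h p.2⟩, by
    have hf : Continuous fun a : W'.Index => W.floor a.val := continuous_of_discreteTopology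
    refine Continuous.subtype_mk (Continuous.prodMk ?_ (hf.comp ?_)) _
    · exact continuous_fst.comp continuous_subtype_val
    · exact continuous_snd.comp continuous_subtype_val⟩
  arr := ⟨fun r => ⟨((r.1.1.1, W.floor r.1.1.2.1.val, W.floor r.1.1.2.2.val), r.1.2),
    mem_interval_floor h r.2.1, mem_interval_floor h r.2.2⟩, by
    have hf : Continuous fun a : W'.Index => W.floor a.val := continuous_of_discreteTopology
    have h1 : Continuous fun r : W'.circle.Arr => r.1 := continuous_subtype_val
    refine Continuous.subtype_mk (Continuous.prodMk (Continuous.prodMk ?_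
      (Continuous.prodMk (hf.comp ?_) (hf.comp ?_))) ?_) _
    · exact continuous_fst.comp (continuous_fst.comp h1)
    · exact continuous_fst.comp (continuous_snd.comp (continuous_fst.comp h1))
    · exact continuous_snd.comp (continuous_snd.comp (continuous_fst.comp h1))
    · exact continuous_snd.comp h1⟩
  src_arr r := rfl
  tgt_arr r := by
    refine Subtype.ext (Prod.ext rfl ?_)
    exact (W.floor_add_int _ _).symm
  arr_unit p := rfl
  arr_comp r r' e := by
    refine Subtype.ext (Prod.ext (Prod.ext rfl (Prod.ext rfl ?_)) rfl)
    exact W.floor_add_int _ _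

theorem refineHom_obj_self (W : CircleCover) (p : W.circle.Obj) :
    (refineHom (le_refl W)).obj p = p :=
  Subtype.ext (Prod.ext rfl (W.floor_val _))

theorem refineHom_arr_self (W : CircleCover) (r : W.circle.Arr) :
    (refineHom (le_refl W)).arr r = r :=
  Subtype.ext (Prod.ext (Prod.ext rfl (Prod.ext (W.floor_val _) (W.floor_val _))) rfl)

theorem refineHom_obj_comp {W W' W'' : CircleCover} (h : W ≤ W') (h' : W' ≤ W'')
    (p : W''.circle.Obj) :
    (refineHom h).obj ((refineHom h').obj p) = (refineHom (h.trans h')).obj p :=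
  Subtype.ext (Prod.ext rfl (floor_floor h _))

theorem refineHom_arr_comp {W W' W'' : CircleCover} (h : W ≤ W') (h' : W' ≤ W'')
    (r : W''.circle.Arr) :
    (refineHom h).arr ((refineHom h').arr r) = (refineHom (h.trans h')).arr r :=
  Subtype.ext (Prod.ext (Prod.ext rfl (Prod.ext (floor_floor h _) (floor_floor h _))) rfl)

/-! ### Rotation of covers -/

/-- The cover obtained by translating by `z`. -/
def rotate (W : CircleCover) (z : ℝ) : CircleCover where
  pts := {p | p - (z : UnitAddCircle) ∈ W.pts}
  finite := W.finite.preimage (sub_left_injective.injOn)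
  nonempty := by
    obtain ⟨p, hp⟩ := W.nonempty
    exact ⟨p + z, by simpa using hp⟩
  ε := W.ε
  ε_pos := W.ε_pos
  admissible a b c ha hb hc hab hbc := by
    refine Set.eq_empty_of_forall_notMem fun x hx => ?_
    have key : ∀ d : ℝ, x ∈ coverInterval {p | p - (z : UnitAddCircle) ∈ W.pts} W.ε d →
        x - z ∈ coverInterval W.pts W.ε (d - z) := by
      intro d hd
      refine ⟨by linarith [hd.1], fun e he hde => ?_⟩
      have := hd.2 (e + z) (by simpa [AddCircle.coe_add] using he) (by linarith)
      linarith
    have h := W.admissible (a - z) (b - z) (c - z) (by simpa [AddCircle.coe_sub] using ha)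
      (by simpa [AddCircle.coe_sub] using hb) (by simpa [AddCircle.coe_sub] using hc)
      (by linarith) (by linarith)
    exact (Set.eq_empty_iff_forall_notMem.1 h) (x - z)
      ⟨⟨key a hx.1.1, key b hx.1.2⟩, key c hx.2⟩

/-- Translating back an index of the translated cover. -/
def Index.unrotate {W : CircleCover} {z : ℝ} (a : (W.rotate z).Index) : W.Index where
  val := a.val - z
  mem := by
    rw [AddCircle.coe_sub]
    exact a.mem

theorem mem_interval_unrotate {W : CircleCover} {z x : ℝ} {a : (W.rotate z).Index}
    (h : x ∈ (W.rotate z).interval a) : x - z ∈ W.interval a.unrotate := by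
  refine ⟨?_, fun e he hde => ?_⟩
  · have h1 : a.val - W.ε < x := h.1
    change a.val - z - W.ε < x - z
    linarith
  · have hde' : a.val - z < e := hde
    have h2 : x < e + z + W.ε := h.2 (e + z)
      (by change _ - _ ∈ W.pts; simpa [AddCircle.coe_add] using he) (by linarith)
    linarith

theorem unrotate_shift {W : CircleCover} {z : ℝ} (a : (W.rotate z).Index) (l : ℤ) :
    (a.shift l).unrotate = a.unrotate.shift l := by
  ext
  simp [Index.unrotate]
  ring

/-- The morphism `(x, a) ↦ (x - z, a - z)` from the groupoid of the translated cover. -/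
def unrotateHom (W : CircleCover) (z : ℝ) : (W.rotate z).circle.Hom W.circle where
  obj := ⟨fun p => ⟨(p.1.1 - z, p.1.2.unrotate), mem_interval_unrotate p.2⟩, by
    have hf : Continuous fun a : (W.rotate z).Index => a.unrotate :=
      continuous_of_discreteTopology
    refine Continuous.subtype_mk (Continuous.prodMk (Continuous.sub ?_ continuous_const)
      (hf.comp ?_)) _
    · exact continuous_fst.comp continuous_subtype_val
    · exact continuous_snd.comp continuous_subtype_val⟩
  arr := ⟨fun r => ⟨((r.1.1.1 - z, r.1.1.2.1.unrotate, r.1.1.2.2.unrotate), r.1.2),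
    mem_interval_unrotate r.2.1, mem_interval_unrotate r.2.2⟩, by
    have hf : Continuous fun a : (W.rotate z).Index => a.unrotate :=
      continuous_of_discreteTopology
    have h1 : Continuous fun r : (W.rotate z).circle.Arr => r.1 := continuous_subtype_val
    refine Continuous.subtype_mk (Continuous.prodMk (Continuous.prodMk
      (Continuous.sub ?_ continuous_const) (Continuous.prodMk (hf.comp ?_) (hf.comp ?_))) ?_) _
    · exact continuous_fst.comp (continuous_fst.comp h1)
    · exact continuous_fst.comp (continuous_snd.comp (continuous_fst.comp h1))
    · exact continuous_snd.comp (continuous_snd.comp (continuous_fst.comp h1))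
    · exact continuous_snd.comp h1⟩
  src_arr r := rfl
  tgt_arr r := by
    refine Subtype.ext (Prod.ext ?_ (unrotate_shift _ _).symm)
    exact (add_sub_right_comm _ _ _).symm
  arr_unit p := rfl
  arr_comp r r' e := by
    refine Subtype.ext (Prod.ext (Prod.ext rfl (Prod.ext rfl ?_)) rfl)
    exact unrotate_shift _ _

theorem rotate_mono {W W' : CircleCover} (h : W ≤ W') (z : ℝ) : W.rotate z ≤ W'.rotate z :=
  ⟨fun _ hp => h.1 hp, h.2⟩

theorem floor_unrotate {W W' : CircleCover} (z : ℝ)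
    (a : (W'.rotate z).Index) : ((W.rotate z).floor a.val).unrotate = W.floor a.unrotate.val := by
  refine (W.floor_eq ?_ fun b hb => ?_).symm
  · exact sub_le_sub_right ((W.rotate z).floor_le a.val) z
  · have hb' : b.val ≤ a.val - z := hb
    have := (W.rotate z).le_floor (x := a.val)
      (b := ⟨b.val + z, by change _ - _ ∈ W.pts; simpa [AddCircle.coe_add] using b.mem⟩)
      (by simp only; linarith)
    change b.val ≤ _ - z
    simp only at this
    linarith

theorem refine_unrotate_obj {W W' : CircleCover} (h : W ≤ W') (z : ℝ)
    (p : (W'.rotate z).circle.Obj) :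
    (W.unrotateHom z).obj ((refineHom (rotate_mono h z)).obj p) =
      (refineHom h).obj ((W'.unrotateHom z).obj p) :=
  Subtype.ext (Prod.ext rfl (floor_unrotate z _))

theorem refine_unrotate_arr {W W' : CircleCover} (h : W ≤ W') (z : ℝ)
    (r : (W'.rotate z).circle.Arr) :
    (W.unrotateHom z).arr ((refineHom (rotate_mono h z)).arr r) =
      (refineHom h).arr ((W'.unrotateHom z).arr r) :=
  Subtype.ext (Prod.ext (Prod.ext rfl (Prod.ext (floor_unrotate z _) (floor_unrotate z _))) rfl)

end CircleCover

namespace TGpd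

/-! ### The loop groupoid -/

section Loop

variable (G : TGpd.{u}) [G.IsTopological]

/-- The directed system of the groupoids `LG(W)` of morphisms from the groupoid of the circle
attached to the cover `W` to `G`. -/
noncomputable def loopSystem : DirSystem.{u} CircleCover where
  gpd W := mapGpd W.circle G
  map _ _ h := precomp (CircleCover.refineHom h) G
  obj_self W F := Hom.ext' (fun x => congrArg F.obj (W.refineHom_obj_self x))
    (fun a => congrArg F.arr (W.refineHom_arr_self a))
  arr_self W L := MapArr.ext'
    (Hom.ext' (fun x => congrArg L.dom.obj (W.refineHom_obj_self x))
      (fun a => congrArg L.dom.arr (W.refineHom_arr_self a)))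
    (Hom.ext' (fun x => congrArg L.cod.obj (W.refineHom_obj_self x))
      (fun a => congrArg L.cod.arr (W.refineHom_arr_self a)))
    (fun r => congrArg L.app (W.refineHom_arr_self r))
  obj_map _ _ _ h h' F :=
    Hom.ext' (fun x => congrArg F.obj (CircleCover.refineHom_obj_comp h h' x))
      (fun a => congrArg F.arr (CircleCover.refineHom_arr_comp h h' a))
  arr_map _ _ _ h h' L := MapArr.ext'
    (Hom.ext' (fun x => congrArg L.dom.obj (CircleCover.refineHom_obj_comp h h' x))
      (fun a => congrArg L.dom.arr (CircleCover.refineHom_arr_comp h h' a)))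
    (Hom.ext' (fun x => congrArg L.cod.obj (CircleCover.refineHom_obj_comp h h' x))
      (fun a => congrArg L.cod.arr (CircleCover.refineHom_arr_comp h h' a)))
    (fun r => congrArg L.app (CircleCover.refineHom_arr_comp h h' r))

/-- The loop groupoid `LG`: the colimit of the `LG(W)` over all admissible covers `W`. -/
noncomputable def loopGpd : TGpd.{u} := G.loopSystem.colimit

/-- The action of `z ∈ ℝ` on the loop groupoid: `Ψ` defined on the cover `W` is sent to `Ψᶻ`
defined on the cover translated by `z`, where `Ψᶻ((x, a, b), l) = Ψ((x - z, a - z, b - z), l)`. -/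
noncomputable def rotateLoop (z : ℝ) : Hom G.loopGpd G.loopGpd :=
  G.loopSystem.desc
    (fun W => (precomp (W.unrotateHom z) G : Hom (mapGpd W.circle G) _).trans
      (G.loopSystem.ι (W.rotate z)))
    (fun W W' h F => by
      refine (G.loopSystem.mkObj_map (W.rotate z) (W'.rotate z)
        (CircleCover.rotate_mono h z) _).symm.trans ?_
      refine congrArg (G.loopSystem.mkObj (W'.rotate z)) ?_
      exact Hom.ext' (fun x => congrArg (Hom.obj F) (CircleCover.refine_unrotate_obj h z x))
        (fun a => congrArg (Hom.arr F) (CircleCover.refine_unrotate_arr h z a)))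
    (fun W W' h L => by
      refine (G.loopSystem.mkArr_map (W.rotate z) (W'.rotate z)
        (CircleCover.rotate_mono h z) _).symm.trans ?_
      refine congrArg (G.loopSystem.mkArr (W'.rotate z)) ?_
      exact MapArr.ext'
        (Hom.ext' (fun x => congrArg (MapArr.dom L).obj (CircleCover.refine_unrotate_obj h z x))
          (fun a => congrArg (MapArr.dom L).arr (CircleCover.refine_unrotate_arr h z a)))
        (Hom.ext' (fun x => congrArg (MapArr.cod L).obj (CircleCover.refine_unrotate_obj h z x))
          (fun a => congrArg (MapArr.cod L).arr (CircleCover.refine_unrotate_arr h z a)))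
        (fun r => congrArg (MapArr.app L) (CircleCover.refine_unrotate_arr h z r)))

/-- The subgroupoid of the loop groupoid fixed by the action of `ℝ`. -/
noncomputable def fixedLoopGpd : TGpd.{u} := G.loopGpd.fixedGpd G.rotateLoop

end Loop

/-! ### Orbifold groupoids, orbifold charts and twisted sectors -/

/-- Orbifold groupoids: proper étale smooth groupoids. The structure maps are continuous, the spaces of objects and of arrows are
(Hausdorff, not necessarily second countable) smooth `n`-manifolds, source and target are local
diffeomorphisms, and `(s, t) : G₁ → G₀ × G₀` is proper. Since `s` and `t` are local
diffeomorphisms, smoothness of the other structure maps follows from their continuity. -/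
structure IsOrbifold (n : ℕ) (G : TGpd.{u}) [G.IsTopological]
    [ChartedSpace (EuclideanSpace ℝ (Fin n)) G.Obj]
    [ChartedSpace (EuclideanSpace ℝ (Fin n)) G.Arr] : Prop where
  t2_obj : T2Space G.Obj
  t2_arr : T2Space G.Arr
  isManifold_obj : IsManifold (𝓡 n) ∞ G.Obj
  isManifold_arr : IsManifold (𝓡 n) ∞ G.Arr
  isLocalDiffeomorph_src : IsLocalDiffeomorph (𝓡 n) (𝓡 n) ∞ G.src
  isLocalDiffeomorph_tgt : IsLocalDiffeomorph (𝓡 n) (𝓡 n) ∞ G.tgt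
  isProperMap : IsProperMap fun a : G.Arr => (G.src a, G.tgt a)

section Sectors

variable (G : TGpd.{u})

/-- The isotropy group `G_x` of arrows from `x` to `x`, with the topology of a subspace of `G₁`. -/
abbrev Isotropy (x : G.Obj) : Type u := {a : G.Arr // G.src a = x ∧ G.tgt a = x}

instance (x : G.Obj) : Group (G.Isotropy x) where
  mul a b := ⟨G.comp a.1 b.1 (a.2.2.trans b.2.1.symm), by simp [a.2.1], by simp [b.2.2]⟩
  one := ⟨G.unit x, by simp, by simp⟩
  inv a := ⟨G.inv a.1, by simp [a.2.2], by simp [a.2.1]⟩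
  mul_assoc a b c := Subtype.ext (G.assoc _ _ _ _ _)
  one_mul a := Subtype.ext (G.unit_comp_of _)
  mul_one a := Subtype.ext (G.comp_unit_of _)
  inv_mul_cancel a := Subtype.ext ((G.inv_comp a.1).trans (congrArg G.unit a.2.2))

/-- The equivalence relation "joined by an arrow" on objects. -/
def orbitSetoid : Setoid G.Obj where
  r x y := ∃ a, G.src a = x ∧ G.tgt a = y
  iseqv :=
    ⟨fun x => ⟨G.unit x, by simp, by simp⟩,
      fun ⟨a, h, h'⟩ => ⟨G.inv a, by simp [h'], by simp [h]⟩,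
      fun ⟨a, h, h'⟩ ⟨b, k, k'⟩ => ⟨G.comp a b (h'.trans k.symm), by simp [h], by simp [k']⟩⟩

/-- The underlying space of points `p` of the orbifold represented by `G`. -/
abbrev OrbitSpace : Type u := Quotient G.orbitSetoid

/-- An orbifold chart `(V, G_x)` at an object `x`: a connected open neighbourhood `V` of `x` in
`G₀`, together with an identification of the restriction of `G` to `V` with the action groupoid of
a right action of the isotropy group `G_x` on `V`. The arrow `arrow (y, g)` goes from `y` to the
point `y · g`; its target defines the action. -/
structure OrbifoldChart (x : G.Obj) where
  V : Set G.Obj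
  isOpen : IsOpen V
  isConnected : IsConnected V
  mem : x ∈ V
  arrow : V × G.Isotropy x ≃ₜ {a : G.Arr // G.src a ∈ V ∧ G.tgt a ∈ V}
  src_arrow : ∀ y g, G.src (arrow (y, g)).1 = y
  arrow_base : ∀ g, (arrow (⟨x, mem⟩, g)).1 = g.1
  arrow_mul : ∀ y g h, (arrow (y, g * h)).1 =
    G.comp (arrow (y, g)).1 (arrow (⟨G.tgt (arrow (y, g)).1, (arrow (y, g)).2.2⟩, h)).1
      (src_arrow ⟨_, (arrow (y, g)).2.2⟩ h).symm

/-- The action `y · g` of the isotropy group on an orbifold chart. -/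
def OrbifoldChart.act {G : TGpd.{u}} {x : G.Obj} (C : G.OrbifoldChart x) (y : C.V)
    (g : G.Isotropy x) : C.V :=
  ⟨G.tgt (C.arrow (y, g)).1, (C.arrow (y, g)).2.2⟩

/-- The fixed point set `V^g` in an orbifold chart. -/
abbrev OrbifoldChart.Fixed {G : TGpd.{u}} {x : G.Obj} (C : G.OrbifoldChart x)
    (g : G.Isotropy x) : Type u :=
  {y : C.V // C.act y g = y}

/-- An orbifold structure `{(V_p, G_p)}` on the orbifold represented by `G`: one orbifold chart at
(an object representing) every point `p`, so that `G_p` is the isotropy group of `pt p`, together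
with a representative of every conjugacy class of every `G_p`. -/
structure OrbifoldAtlas where
  pt : G.OrbitSpace → G.Obj
  pt_eq : ∀ p, Quotient.mk G.orbitSetoid (pt p) = p
  chart : ∀ p, G.OrbifoldChart (pt p)
  rep : ∀ p, ConjClasses (G.Isotropy (pt p)) → G.Isotropy (pt p)
  rep_eq : ∀ p c, ConjClasses.mk (rep p c) = c

namespace OrbifoldAtlas

variable {G : TGpd.{u}} (A : G.OrbifoldAtlas)

/-- The set of points of the twisted sectors: pairs `(p, (g))` of a point `p` of the orbifold and a
conjugacy class `(g)` in `G_p`. -/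
abbrev SectorPoint : Type u := Σ p : G.OrbitSpace, ConjClasses (G.Isotropy (A.pt p))

/-- The disjoint union of the charts `V_p^g` of the twisted sectors over all `(p, (g))`. -/
abbrev SectorObj : Type u := Σ q : A.SectorPoint, (A.chart q.1).Fixed (A.rep q.1 q.2)

/-- The object of `G` underlying a point of a chart of the twisted sectors. -/
def base (y : A.SectorObj) : G.Obj := y.2.1.1

/-- For a point `y` of the chart `V_p^g`, the element `g`, regarded as an arrow `y → y`. -/
def loop (y : A.SectorObj) : G.Arr := ((A.chart y.1.1).arrow (y.2.1, A.rep y.1.1 y.1.2)).1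

theorem src_loop (y : A.SectorObj) : G.src (A.loop y) = A.base y :=
  (A.chart y.1.1).src_arrow _ _

theorem tgt_loop (y : A.SectorObj) : G.tgt (A.loop y) = A.base y :=
  congrArg Subtype.val y.2.2

/-- For `y ∈ V_p^g` and `y' ∈ V_q^h`, the arrow `a` of `G` goes from `y` to `y'` and intertwines
`g` and `h`. -/
def Intertwines (y : A.SectorObj) (a : G.Arr) (y' : A.SectorObj) : Prop :=
  ∃ (hs : G.src a = A.base y) (ht : G.tgt a = A.base y'),
    G.comp (A.loop y) a ((A.tgt_loop y).trans hs.symm) =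
      G.comp a (A.loop y') (ht.trans (A.src_loop y').symm)

variable {A}

theorem intertwines_unit (y : A.SectorObj) : A.Intertwines y (G.unit (A.base y)) y :=
  ⟨G.src_unit _, G.tgt_unit _, (G.comp_unit_of _).trans (G.unit_comp_of _).symm⟩

theorem Intertwines.inv {y y' : A.SectorObj} {a : G.Arr} (h : A.Intertwines y a y') :
    A.Intertwines y' (G.inv a) y := by
  obtain ⟨hs, ht, e⟩ := h
  refine ⟨(G.src_inv a).trans ht, (G.tgt_inv a).trans hs, ?_⟩
  have hc : G.tgt (A.loop y) = G.src a := (A.tgt_loop y).trans hs.symm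
  have h0 : G.tgt (G.inv a) = G.src (G.comp (A.loop y) a hc) := by
    rw [G.tgt_inv, G.src_comp, A.src_loop, hs]
  have h1 : G.comp (G.inv a) (G.comp (A.loop y) a hc) h0 = A.loop y' := by
    rw [G.comp_congr rfl e]
    exact G.inv_comp_cancel _ _
  have h2 : G.tgt (G.comp (A.loop y) a hc) = G.src (G.inv a) := by
    rw [G.tgt_comp, G.src_inv]
  have h3 : G.comp (G.comp (A.loop y) a hc) (G.inv a) h2 = A.loop y := by
    rw [G.assoc _ _ _ hc (G.src_inv a).symm, G.comp_congr rfl (G.comp_inv a)]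
    exact G.comp_unit_of _
  rw [G.comp_congr h1.symm rfl, G.assoc _ _ _ h0 h2]
  exact G.comp_congr rfl h3 _

theorem Intertwines.composable {x y z : A.SectorObj} {a b : G.Arr} (h : A.Intertwines x a y)
    (h' : A.Intertwines y b z) : G.tgt a = G.src b :=
  h.2.1.trans h'.1.symm

theorem Intertwines.comp {x y z : A.SectorObj} {a b : G.Arr} (h : A.Intertwines x a y)
    (h' : A.Intertwines y b z) : A.Intertwines x (G.comp a b (h.composable h')) z := by
  have hab := h.composable h'
  obtain ⟨hs, ht, e⟩ := h
  obtain ⟨hs', ht', e'⟩ := h'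
  refine ⟨(G.src_comp _ _ _).trans hs, (G.tgt_comp _ _ _).trans ht', ?_⟩
  rw [← G.assoc _ _ _ ((A.tgt_loop x).trans hs.symm) hab, G.comp_congr e rfl,
    G.assoc _ _ _ (ht.trans (A.src_loop y).symm) ((A.tgt_loop y).trans hs'.symm),
    G.comp_congr rfl e']
  exact (G.assoc _ _ _ _ _).symm

variable (A)

/-- An arrow of the twisted sectors from `y ∈ V_p^g` to `y' ∈ V_q^h` is an arrow `a : y → y'` of `G`
that intertwines `g` and `h`. -/
abbrev SectorArr : Type u :=
  {r : A.SectorObj × G.Arr × A.SectorObj // A.Intertwines r.1 r.2.1 r.2.2}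

/-- Composition of arrows of the twisted sectors. -/
def sectorComp (r r' : A.SectorArr) (h : r.1.2.2 = r'.1.1) : A.SectorArr :=
  have hr : A.Intertwines r.1.2.2 r'.1.2.1 r'.1.2.2 := by
    rw [h]
    exact r'.2
  ⟨(r.1.1, G.comp r.1.2.1 r'.1.2.1 (r.2.composable hr), r'.1.2.2), r.2.comp hr⟩

theorem sectorArr_ext {r r' : A.SectorArr} (h1 : r.1.1 = r'.1.1) (h2 : r.1.2.1 = r'.1.2.1)
    (h3 : r.1.2.2 = r'.1.2.2) : r = r' :=
  Subtype.ext (Prod.ext h1 (Prod.ext h2 h3))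

/-- The groupoid of twisted sectors: the orbifold with points `(p, (g))` and charts
`(V_p^g, C(g))`. Its objects are the disjoint union of the `V_p^g` over all `(p, (g))`, its arrows
are the arrows of `G` that intertwine the corresponding group elements; in particular its
restriction to `V_p^g` is the action groupoid of the centralizer `C(g)` on `V_p^g`. -/
def twistedSectors : TGpd.{u} where
  Obj := A.SectorObj
  Arr := A.SectorArr
  src r := r.1.1
  tgt r := r.1.2.2
  unit y := ⟨(y, G.unit (A.base y), y), intertwines_unit y⟩
  inv r := ⟨(r.1.2.2, G.inv r.1.2.1, r.1.1), r.2.inv⟩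
  comp := A.sectorComp
  src_unit _ := rfl
  tgt_unit _ := rfl
  src_inv _ := rfl
  tgt_inv _ := rfl
  src_comp _ _ _ := rfl
  tgt_comp _ _ _ := rfl
  unit_comp r := A.sectorArr_ext rfl (G.unit_comp_of ((G.tgt_unit _).trans r.2.1.symm)) rfl
  comp_unit r := A.sectorArr_ext rfl (G.comp_unit_of (r.2.2.1.trans (G.src_unit _).symm)) rfl
  inv_comp r := A.sectorArr_ext rfl ((G.inv_comp _).trans (congrArg G.unit r.2.2.1)) rfl
  comp_inv r := A.sectorArr_ext rfl ((G.comp_inv _).trans (congrArg G.unit r.2.1)) rfl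
  assoc r r' r'' h h' := by
    obtain ⟨⟨x, a, y⟩, hr⟩ := r
    obtain ⟨⟨y', b, z⟩, hr'⟩ := r'
    obtain ⟨⟨z', c, w⟩, hr''⟩ := r''
    obtain rfl : y = y' := h
    obtain rfl : z = z' := h'
    exact A.sectorArr_ext rfl
      (G.assoc a b c (hr.composable hr') (hr'.composable hr'')) rfl

end OrbifoldAtlas

end Sectors

end TGpd

/-! Both groupoids are compared with the inertia groupoid, whose objects are the loops `g : x → x`
of `G` and whose arrows are arrows of `G` acting by conjugation. The fixed loop groupoid is
isomorphic to it, as a groupoid with topologies, and the twisted sectors map to it by a Morita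
morphism.

A loop `g` gives a constant morphism on the groupoid of any cover, with value `g ^ l` on arrows of
winding number `l`; its class in the colimit does not depend on the cover, so it is fixed by
rotations. Conversely, let a class be fixed. For each `z` a representative agrees with its rotation
by `z`, but only after a refinement that may depend on `z`. The combinatorial core,
`exists_refinement_eq_baseArr`, shows that nevertheless one refinement makes the representative
depend on winding numbers only. Rotating a point `x` to `0` settles the arrows whose two charts are
the one of the nearest point to the left of `x`; one further rotation, moving every point of the
cover off the cover, brings all other arrows of a shrunken cover to this form. A morphism depending
only on winding numbers is a homomorphism from the integers to an isotropy group, that is, a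
constant loop; the same argument applies to arrows. Evaluation at the base point of the circle is
continuous on the colimit and recovers the loop, so the bijection is a homeomorphism. Transport
along it also shows that the fixed loop groupoid is topological, which is not evident from the
colimit topologies.

A point `y` of `V_p^g` gives the loop `(y, g)`. This map is full and faithful by construction, meets
every conjugacy class of loops because the charts are centred at representatives of all orbits, and
is open because isotropy groups are discrete: `isMorita_toInertia`.

Charts come from the local inverses of the source map through the finitely many isotropy arrows at
`x`. Properness leaves no other arrows near `x`, and continuity of composition makes the sections
multiplicative on a small invariant neighbourhood, of which the component of `x` is taken. -/

/-- The base change of an open map along a continuous map is open. -/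
theorem IsOpenMap.pullback_snd {X Y Z : Type*} [TopologicalSpace X] [TopologicalSpace Y]
    [TopologicalSpace Z] {f : X → Z} {g : Y → Z} (hf : IsOpenMap f) (hg : Continuous g) :
    IsOpenMap fun p : {p : X × Y // f p.1 = g p.2} => p.1.2 := by
  rintro U ⟨O, hO, rfl⟩
  rw [isOpen_iff_mem_nhds]
  rintro _ ⟨⟨⟨x, y⟩, hxy⟩, hO', rfl⟩
  obtain ⟨A, hA, B, hB, hAB⟩ := mem_nhds_prod_iff.1 (hO.mem_nhds hO')
  have h1 : g ⁻¹' (f '' A) ∈ nhds y :=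
    hg.continuousAt.preimage_mem_nhds (by rw [← hxy]; exact hf.image_mem_nhds hA)
  filter_upwards [hB, h1] with y' hy' ⟨x', hx', e⟩
  exact ⟨⟨(x', y'), e⟩, hAB ⟨hx', hy'⟩, rfl⟩

namespace TGpd

/-! ### Morita morphisms -/

namespace Hom

/-- The identity morphism. -/
def id (H : TGpd.{u}) : Hom H H where
  obj := ContinuousMap.id _
  arr := ContinuousMap.id _
  src_arr _ := rfl
  tgt_arr _ := rfl
  arr_unit _ := rfl
  arr_comp _ _ _ := rfl

/-- For the identity, the space of pairs in the second condition is a copy of the arrow space and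
the map on it is the source map; this is why openness of the source is what the identity needs to be
Morita. -/
theorem isMorita_id {H : TGpd.{u}} (hc : H.IsTopological) (ho : IsOpenMap H.src) :
    (Hom.id H).IsMorita where
  cartesian := by
    rw [isHomeomorph_iff_exists_inverse]
    refine ⟨Continuous.subtype_mk ((hc.continuous_src.prodMk hc.continuous_tgt).prodMk
      continuous_id) _, fun p => p.1.2, fun _ => rfl, ?_, by fun_prop⟩
    rintro ⟨⟨⟨x, y⟩, a⟩, h1, h2⟩
    exact Subtype.ext (Prod.ext (Prod.ext h1 h2) rfl)
  surjective x := ⟨⟨(x, H.unit x), (H.tgt_unit x).symm⟩, H.src_unit x⟩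
  isOpenMap := by
    refine IsOpenMap.of_comp
      (f := fun a : H.Arr => (⟨(H.tgt a, a), rfl⟩ :
        {p : H.Obj × H.Arr // (Hom.id H).obj p.1 = H.tgt p.2})) ?_ ?_ ho
    · exact Continuous.subtype_mk (hc.continuous_tgt.prodMk continuous_id) _
    · rintro ⟨⟨x, a⟩, h⟩
      exact ⟨a, Subtype.ext (Prod.ext h.symm rfl)⟩

/-- The source of a Morita morphism has an open source map. -/
theorem IsMorita.isOpenMap_src {K : TGpd.{v}} {H : TGpd.{u}} {F : Hom K H} (hF : F.IsMorita) :
    IsOpenMap K.src := by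
  -- The base change consists of triples `(y, a, x)` with `a : F x → F y`. By the cartesian square
  -- these are the arrows `x → y` of `K`, and the projection to `x` is the source map.
  have h := hF.isOpenMap.pullback_snd F.obj.continuous
  obtain ⟨-, i, -, hi, hic⟩ := isHomeomorph_iff_exists_inverse.1 hF.cartesian
  refine IsOpenMap.of_comp
    (f := fun p : {p : {p : K.Obj × H.Arr // F.obj p.1 = H.tgt p.2} × K.Obj //
      H.src p.1.1.2 = F.obj p.2} => i ⟨((p.1.2, p.1.1.1.1), p.1.1.1.2), p.2, p.1.1.2.symm⟩)
    (hic.comp (Continuous.subtype_mk (by fun_prop) _)) ?_ ?_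
  · intro a
    refine ⟨⟨(⟨(K.tgt a, F.arr a), (F.tgt_arr a).symm⟩, K.src a), F.src_arr a⟩, ?_⟩
    exact hF.cartesian.injective (hi _)
  · convert h using 1
    funext p
    exact congrArg (fun q => q.1.1.1) (hi ⟨((p.1.2, p.1.1.1.1), p.1.1.1.2), p.2, p.1.1.2.symm⟩)

/-- Composing a Morita morphism with an isomorphism gives a Morita morphism. -/
theorem IsMorita.trans_iso {K : TGpd.{v}} {H L : TGpd.{u}} {F : Hom K H} (hF : F.IsMorita)
    {E : Hom H L} (h0 : IsHomeomorph E.obj) (h1 : IsHomeomorph E.arr)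
    (hK : K.IsTopological) : (F.trans E).IsMorita where
  cartesian := by
    obtain ⟨-, i, hi', hi, hic⟩ := isHomeomorph_iff_exists_inverse.1 hF.cartesian
    obtain ⟨-, j, hj', hj, hjc⟩ := isHomeomorph_iff_exists_inverse.1 h1
    rw [isHomeomorph_iff_exists_inverse]
    refine ⟨Continuous.subtype_mk ((hK.continuous_src.prodMk hK.continuous_tgt).prodMk
      (F.trans E).arr.continuous) _, fun p => i ⟨(p.1.1, j p.1.2), ?_, ?_⟩, ?_, ?_, ?_⟩
    · exact h0.injective (by rw [← E.src_arr, hj]; exact p.2.1)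
    · exact h0.injective (by rw [← E.tgt_arr, hj]; exact p.2.2)
    · intro a
      refine Eq.trans (congrArg i ?_) (hi' a)
      exact Subtype.ext (Prod.ext rfl (hj' _))
    · rintro ⟨⟨⟨x, y⟩, a⟩, e⟩
      refine Subtype.ext (Prod.ext ?_ ?_)
      · exact congrArg (fun q => q.1.1) (hi ⟨((x, y), j a), _⟩)
      · exact (congrArg E.arr (congrArg (fun q => q.1.2) (hi ⟨((x, y), j a), _⟩))).trans (hj a)
    · exact hic.comp (Continuous.subtype_mk ((by fun_prop : Continuous fun p : {p :
        (K.Obj × K.Obj) × L.Arr // L.src p.2 = (F.trans E).obj p.1.1 ∧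
          L.tgt p.2 = (F.trans E).obj p.1.2} => (p.1.1)).prodMk (hjc.comp (by fun_prop))) _)
  surjective x := by
    obtain ⟨y, rfl⟩ := h0.surjective x
    obtain ⟨⟨⟨k, a⟩, e⟩, rfl⟩ := hF.surjective y
    exact ⟨⟨(k, E.arr a), (congrArg E.obj e).trans (E.tgt_arr a).symm⟩, E.src_arr a⟩
  isOpenMap := by
    refine IsOpenMap.of_comp
      (f := fun p : {p : K.Obj × H.Arr // F.obj p.1 = H.tgt p.2} =>
        (⟨(p.1.1, E.arr p.1.2), (congrArg E.obj p.2).trans (E.tgt_arr _).symm⟩ :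
        {p : K.Obj × L.Arr // (F.trans E).obj p.1 = L.tgt p.2})) ?_ ?_ ?_
    · exact Continuous.subtype_mk (by fun_prop) _
    · rintro ⟨⟨k, a⟩, e⟩
      obtain ⟨a, rfl⟩ := h1.surjective a
      exact ⟨⟨(k, a), h0.injective (Eq.trans e (E.tgt_arr a))⟩, rfl⟩
    · convert h0.isOpenMap.comp hF.isOpenMap using 1
      funext p
      exact E.src_arr _

/-- A groupoid isomorphic to a topological groupoid is a topological groupoid. -/
theorem isTopological_of_iso {H L : TGpd.{u}} {E : Hom H L} (h0 : IsHomeomorph E.obj)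
    (h1 : IsHomeomorph E.arr) (hH : H.IsTopological) : L.IsTopological := by
  obtain ⟨-, j, -, hj, hjc⟩ := isHomeomorph_iff_exists_inverse.1 h1
  obtain ⟨-, k, -, hk, hkc⟩ := isHomeomorph_iff_exists_inverse.1 h0
  refine ⟨?_, ?_, ?_, ?_, ?_⟩
  · refine (E.obj.continuous.comp (hH.continuous_src.comp hjc)).congr fun a => ?_
    simp only [Function.comp_apply, ← E.src_arr, hj a]
  · refine (E.obj.continuous.comp (hH.continuous_tgt.comp hjc)).congr fun a => ?_
    simp only [Function.comp_apply, ← E.tgt_arr, hj a]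
  · refine (E.arr.continuous.comp (hH.continuous_unit.comp hkc)).congr fun a => ?_
    simp only [Function.comp_apply, E.arr_unit, hk a]
  · refine (E.arr.continuous.comp (hH.continuous_inv.comp hjc)).congr fun a => ?_
    simp only [Function.comp_apply, E.arr_inv, hj a]
  · have hp : ∀ p : {p : L.Arr × L.Arr // L.tgt p.1 = L.src p.2},
        H.tgt (j p.1.1) = H.src (j p.1.2) := fun p =>
      h0.injective (by rw [← E.tgt_arr, ← E.src_arr, hj, hj]; exact p.2)
    refine (E.arr.continuous.comp (H.continuous_comp_of (hjc.comp (by fun_prop :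
      Continuous fun p : {p : L.Arr × L.Arr // L.tgt p.1 = L.src p.2} => p.1.1))
      (hjc.comp (by fun_prop)) hp)).congr fun p => ?_
    simp only [Function.comp_apply, E.arr_comp]
    exact L.comp_congr (hj _) (hj _) _

/-- A Morita morphism followed by an isomorphism gives a Morita equivalence. -/
theorem IsMorita.moritaEquivalent {K H L : TGpd.{u}} {F : Hom K H} (hF : F.IsMorita)
    {E : Hom H L} (h0 : IsHomeomorph E.obj) (h1 : IsHomeomorph E.arr)
    (hK : K.IsTopological) (hH : H.IsTopological) : MoritaEquivalent L K :=
  -- `K` itself is the apex of the span: one leg is `F` followed by the isomorphism, the other the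
  -- identity.
  ⟨isTopological_of_iso h0 h1 hH, hK, K, hK, F.trans E, Hom.id K, hF.trans_iso h0 h1 hK,
    isMorita_id hK hF.isOpenMap_src⟩

end Hom

/-! ### The inertia groupoid -/

section Inertia

variable (G : TGpd.{u})

/-- The set of loops of a groupoid: arrows with equal source and target. -/
abbrev Loop : Type u := {g : G.Arr // G.tgt g = G.src g}

variable {G}

/-- The arrow `a` conjugates the loop `g` to the loop `h`. -/
def Loop.Conj (g : G.Loop) (a : G.Arr) (h : G.Loop) : Prop :=
  ∃ (hs : G.src a = G.src g.1) (ht : G.tgt a = G.src h.1),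
    G.comp g.1 a (g.2.trans hs.symm) = G.comp a h.1 ht

theorem Loop.conj_unit (g : G.Loop) : g.Conj (G.unit (G.src g.1)) g :=
  ⟨G.src_unit _, G.tgt_unit _, (G.comp_unit_of _).trans (G.unit_comp_of _).symm⟩

theorem Loop.Conj.inv {g h : G.Loop} {a : G.Arr} (H : g.Conj a h) : h.Conj (G.inv a) g := by
  obtain ⟨hs, ht, e⟩ := H
  refine ⟨(G.src_inv a).trans ht, (G.tgt_inv a).trans hs, ?_⟩
  have hc : G.tgt g.1 = G.src a := g.2.trans hs.symm
  have h0 : G.tgt (G.inv a) = G.src (G.comp g.1 a hc) := by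
    rw [G.tgt_inv, G.src_comp, hs]
  have h1 : G.comp (G.inv a) (G.comp g.1 a hc) h0 = h.1 := by
    rw [G.comp_congr rfl e]
    exact G.inv_comp_cancel _ _
  have h2 : G.tgt (G.comp g.1 a hc) = G.src (G.inv a) := by
    rw [G.tgt_comp, G.src_inv]
  have h3 : G.comp (G.comp g.1 a hc) (G.inv a) h2 = g.1 := by
    rw [G.assoc _ _ _ hc (G.src_inv a).symm, G.comp_congr rfl (G.comp_inv a)]
    exact G.comp_unit_of _
  rw [G.comp_congr h1.symm rfl, G.assoc _ _ _ h0 h2]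
  exact G.comp_congr rfl h3 _

theorem Loop.Conj.composable {g h k : G.Loop} {a b : G.Arr} (H : g.Conj a h)
    (H' : h.Conj b k) : G.tgt a = G.src b :=
  H.2.1.trans H'.1.symm

theorem Loop.Conj.comp {g h k : G.Loop} {a b : G.Arr} (H : g.Conj a h)
    (H' : h.Conj b k) : g.Conj (G.comp a b (H.composable H')) k := by
  have hab := H.composable H'
  obtain ⟨hs, ht, e⟩ := H
  obtain ⟨hs', ht', e'⟩ := H'
  refine ⟨(G.src_comp _ _ _).trans hs, (G.tgt_comp _ _ _).trans ht', ?_⟩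
  rw [← G.assoc _ _ _ (g.2.trans hs.symm) hab, G.comp_congr e rfl,
    G.assoc _ _ _ ht (h.2.trans hs'.symm), G.comp_congr rfl e']
  exact (G.assoc _ _ _ _ _).symm

/-- The conjugate `a⁻¹ g a` of a loop `g` by an arrow `a` starting at its base point. -/
def Loop.conjBy (g : G.Loop) (a : G.Arr) (h : G.src a = G.src g.1) : G.Loop :=
  ⟨G.comp (G.inv a) (G.comp g.1 a (g.2.trans h.symm)) (by simp [h]), by simp⟩

theorem Loop.conj_conjBy (g : G.Loop) (a : G.Arr) (h : G.src a = G.src g.1) :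
    g.Conj a (g.conjBy a h) :=
  ⟨h, by simp [conjBy], (G.comp_inv_cancel _ _).symm⟩

theorem Loop.Conj.eq_conjBy {g h : G.Loop} {a : G.Arr} (H : g.Conj a h) :
    h = g.conjBy a H.1 := by
  refine Subtype.ext ?_
  change _ = G.comp _ _ _
  rw [G.comp_congr rfl H.2.2]
  exact (G.inv_comp_cancel _ _).symm

variable (G)

/-- The arrows of the inertia groupoid. -/
abbrev InertiaArr : Type u := {r : G.Loop × G.Arr × G.Loop // r.1.Conj r.2.1 r.2.2}

variable {G}

theorem inertiaArr_ext {r r' : G.InertiaArr} (h1 : r.1.1 = r'.1.1) (h2 : r.1.2.1 = r'.1.2.1)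
    (h3 : r.1.2.2 = r'.1.2.2) : r = r' :=
  Subtype.ext (Prod.ext h1 (Prod.ext h2 h3))

/-- Composition of arrows of the inertia groupoid. -/
def inertiaComp (r r' : G.InertiaArr) (h : r.1.2.2 = r'.1.1) : G.InertiaArr :=
  have hr : r.1.2.2.Conj r'.1.2.1 r'.1.2.2 := by
    rw [h]
    exact r'.2
  ⟨(r.1.1, G.comp r.1.2.1 r'.1.2.1 (r.2.composable hr), r'.1.2.2), r.2.comp hr⟩

variable (G)

/-- The inertia groupoid: its objects are the loops of `G`, its arrows are the arrows of `G`
acting on loops by conjugation. -/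
def inertia : TGpd.{u} where
  Obj := G.Loop
  Arr := G.InertiaArr
  src r := r.1.1
  tgt r := r.1.2.2
  unit g := ⟨(g, G.unit (G.src g.1), g), g.conj_unit⟩
  inv r := ⟨(r.1.2.2, G.inv r.1.2.1, r.1.1), r.2.inv⟩
  comp := inertiaComp
  src_unit _ := rfl
  tgt_unit _ := rfl
  src_inv _ := rfl
  tgt_inv _ := rfl
  src_comp _ _ _ := rfl
  tgt_comp _ _ _ := rfl
  unit_comp r := inertiaArr_ext rfl (G.unit_comp_of ((G.tgt_unit _).trans r.2.1.symm)) rfl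
  comp_unit r := inertiaArr_ext rfl (G.comp_unit_of (r.2.2.1.trans (G.src_unit _).symm)) rfl
  inv_comp r := inertiaArr_ext rfl ((G.inv_comp _).trans (congrArg G.unit r.2.2.1)) rfl
  comp_inv r := inertiaArr_ext rfl ((G.comp_inv _).trans (congrArg G.unit r.2.1)) rfl
  assoc r r' r'' h h' := by
    obtain ⟨⟨x, a, y⟩, hr⟩ := r
    obtain ⟨⟨y', b, z⟩, hr'⟩ := r'
    obtain ⟨⟨z', c, w⟩, hr''⟩ := r''
    obtain rfl : y = y' := h
    obtain rfl : z = z' := h'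
    exact inertiaArr_ext rfl (G.assoc a b c (hr.composable hr') (hr'.composable hr'')) rfl

variable [hG : G.IsTopological]

theorem inertia_isTopological : G.inertia.IsTopological where
  continuous_src := continuous_fst.comp continuous_subtype_val
  continuous_tgt := continuous_snd.comp (continuous_snd.comp continuous_subtype_val)
  continuous_unit := Continuous.subtype_mk (continuous_id.prodMk ((hG.continuous_unit.comp
    (hG.continuous_src.comp continuous_subtype_val)).prodMk continuous_id)) _
  continuous_inv := by
    have h : Continuous fun r : G.InertiaArr => r.1 := continuous_subtype_val
    exact Continuous.subtype_mk (h.snd.snd.prodMk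
      ((hG.continuous_inv.comp h.snd.fst).prodMk h.fst)) _
  continuous_comp := by
    have h : Continuous fun p : {p : G.InertiaArr × G.InertiaArr // p.1.1.2.2 = p.2.1.1} =>
      (p.1.1.1, p.1.2.1) := by fun_prop
    exact Continuous.subtype_mk (h.fst.fst.prodMk ((G.continuous_comp_of h.fst.snd.fst
      h.snd.snd.fst _).prodMk h.snd.snd.snd)) _

/-- An arrow of the inertia groupoid is determined by its source and the conjugating arrow. -/
def inertiaArrHomeo : {p : G.Arr × G.Loop // G.src p.1 = G.src p.2.1} ≃ₜ G.InertiaArr where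
  toFun p := ⟨(p.1.2, p.1.1, p.1.2.conjBy p.1.1 p.2), p.1.2.conj_conjBy _ p.2⟩
  invFun r := ⟨(r.1.2.1, r.1.1), r.2.1⟩
  left_inv _ := rfl
  right_inv r := inertiaArr_ext rfl rfl r.2.eq_conjBy.symm
  continuous_toFun := by
    have h : Continuous fun p : {p : G.Arr × G.Loop // G.src p.1 = G.src p.2.1} => p.1 :=
      continuous_subtype_val
    refine Continuous.subtype_mk (h.snd.prodMk (h.fst.prodMk (Continuous.subtype_mk ?_ _))) _
    exact G.continuous_comp_of (hG.continuous_inv.comp h.fst) (G.continuous_comp_of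
      (continuous_subtype_val.comp h.snd) h.fst _) _
  continuous_invFun := by
    have h : Continuous fun r : G.InertiaArr => r.1 := continuous_subtype_val
    exact (h.snd.fst.prodMk h.fst).subtype_mk _

/-- In the coordinates of `inertiaArrHomeo`, this is the base change of the source map of `G` along
the map sending a loop to its base point. -/
theorem inertia_isOpenMap_src (ho : IsOpenMap G.src) : IsOpenMap G.inertia.src :=
  (ho.pullback_snd (hG.continuous_src.comp continuous_subtype_val)).comp
    G.inertiaArrHomeo.symm.isOpenMap

end Inertia

/-! ### Twisted sectors and the inertia groupoid -/

namespace OrbifoldAtlas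

variable {G : TGpd.{u}} (A : G.OrbifoldAtlas)

/-- The loop of `G` attached to a point of the twisted sectors. -/
def toLoop (y : A.SectorObj) : G.Loop := ⟨A.loop y, (A.tgt_loop y).trans (A.src_loop y).symm⟩

theorem intertwines_iff {y y' : A.SectorObj} {a : G.Arr} :
    A.Intertwines y a y' ↔ (A.toLoop y).Conj a (A.toLoop y') :=
  ⟨fun ⟨hs, ht, e⟩ => ⟨hs.trans (A.src_loop y).symm, ht.trans (A.src_loop y').symm, e⟩,
    fun ⟨hs, ht, e⟩ => ⟨hs.trans (A.src_loop y), ht.trans (A.src_loop y'), e⟩⟩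

theorem continuous_toLoop : Continuous A.toLoop := by
  refine Continuous.subtype_mk (continuous_sigma fun q => ?_) _
  have h : Continuous fun y : (A.chart q.1).Fixed (A.rep q.1 q.2) =>
    ((A.chart q.1).arrow (y.1, A.rep q.1 q.2)).1 := by fun_prop
  exact h

theorem continuous_base : Continuous A.base :=
  continuous_sigma fun _ => continuous_subtype_val.comp continuous_subtype_val

/-- Every loop is conjugate to one that comes from a point of the twisted sectors. -/
theorem exists_conj_toLoop (g : G.Loop) : ∃ a y, g.Conj a (A.toLoop y) := by
  set p : G.OrbitSpace := Quotient.mk _ (G.src g.1)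
  -- An arrow to the chosen representative of the orbit; conjugation by it makes `g` an element `k`
  -- of the isotropy group at `A.pt p`.
  obtain ⟨b, hb, hb'⟩ : ∃ b, G.src b = G.src g.1 ∧ G.tgt b = A.pt p :=
    Quotient.exact (A.pt_eq p).symm
  let k : G.Isotropy (A.pt p) := ⟨(g.conjBy b hb).1, by simp [Loop.conjBy, hb'],
    by simp [Loop.conjBy, hb']⟩
  -- A second conjugation, inside the isotropy group, replaces `k` by the chosen representative of
  -- its class.
  obtain ⟨c, hc⟩ := isConj_iff.1 (ConjClasses.mk_eq_mk_iff_isConj.1 (A.rep_eq p (.mk k)))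
  have hbase : ((A.chart p).arrow (⟨A.pt p, (A.chart p).mem⟩, A.rep p (.mk k))).1 =
    (A.rep p (.mk k)).1 := (A.chart p).arrow_base _
  -- The centre of the chart is a fixed point of every group element, since over it `arrow` returns
  -- the element itself.
  let y : A.SectorObj := ⟨⟨p, .mk k⟩, ⟨⟨A.pt p, (A.chart p).mem⟩, Subtype.ext (by
    change G.tgt ((A.chart p).arrow _).1 = A.pt p
    rw [hbase]
    exact (A.rep p (.mk k)).2.2)⟩⟩
  have hy : A.loop y = (A.rep p (.mk k)).1 := hbase
  have hc' : k * c = c * A.rep p (.mk k) := (mul_inv_eq_iff_eq_mul.1 hc).symm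
  have hk : (g.conjBy b hb).Conj c.1 (A.toLoop y) := by
    refine ⟨c.2.1.trans k.2.1.symm, c.2.2.trans (A.src_loop y).symm, ?_⟩
    refine (congrArg Subtype.val hc').trans ?_
    exact G.comp_congr rfl hy.symm _
  exact ⟨_, y, (g.conj_conjBy b hb).comp hk⟩

variable [hG : G.IsTopological]

theorem twistedSectors_isTopological : A.twistedSectors.IsTopological where
  continuous_src := continuous_fst.comp continuous_subtype_val
  continuous_tgt := continuous_snd.comp (continuous_snd.comp continuous_subtype_val)
  continuous_unit := Continuous.subtype_mk (continuous_id.prodMk ((hG.continuous_unit.comp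
    A.continuous_base).prodMk continuous_id)) _
  continuous_inv := by
    have h : Continuous fun r : A.SectorArr => r.1 := continuous_subtype_val
    exact Continuous.subtype_mk (h.snd.snd.prodMk
      ((hG.continuous_inv.comp h.snd.fst).prodMk h.fst)) _
  continuous_comp := by
    have h : Continuous fun p : {p : A.SectorArr × A.SectorArr // p.1.1.2.2 = p.2.1.1} =>
      (p.1.1.1, p.1.2.1) := by fun_prop
    exact Continuous.subtype_mk (h.fst.fst.prodMk ((G.continuous_comp_of h.fst.snd.fst
      h.snd.snd.fst _).prodMk h.snd.snd.snd)) _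

/-- The morphism from the twisted sectors to the inertia groupoid. -/
def toInertia : Hom A.twistedSectors G.inertia where
  obj := ⟨A.toLoop, A.continuous_toLoop⟩
  arr := ⟨fun r => ⟨(A.toLoop r.1.1, r.1.2.1, A.toLoop r.1.2.2), A.intertwines_iff.1 r.2⟩, by
    have h : Continuous fun r : A.SectorArr => r.1 := continuous_subtype_val
    exact Continuous.subtype_mk ((A.continuous_toLoop.comp h.fst).prodMk
      (h.snd.fst.prodMk (A.continuous_toLoop.comp h.snd.snd))) _⟩
  src_arr _ := rfl
  tgt_arr _ := rfl
  arr_unit y := inertiaArr_ext rfl (congrArg G.unit (A.src_loop y).symm) rfl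
  arr_comp _ _ _ := rfl

/-- If the isotropy groups are discrete, the points of the twisted sectors map openly to the
space of loops. -/
theorem isOpenMap_toLoop (hd : ∀ x, DiscreteTopology (G.Isotropy x)) : IsOpenMap A.toLoop := by
  refine isOpenMap_sigma.2 fun q => ?_
  rintro U ⟨O, hO, rfl⟩
  have hV := (A.chart q.1).isOpen
  -- Discreteness makes the slice of a single group element open, so its image under the chart is
  -- open in the arrow space. The loops in that image are exactly the wanted image of `U`.
  have h1 : IsOpen (O ×ˢ {A.rep q.1 q.2} : Set ((A.chart q.1).V × G.Isotropy (A.pt q.1))) :=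
    hO.prod (isOpen_discrete _)
  have h2 : IsOpen {a : G.Arr | G.src a ∈ (A.chart q.1).V ∧ G.tgt a ∈ (A.chart q.1).V} :=
    (hV.preimage hG.continuous_src).inter (hV.preimage hG.continuous_tgt)
  have h3 := h2.isOpenMap_subtype_val _ ((A.chart q.1).arrow.isOpenMap _ h1)
  convert h3.preimage (continuous_subtype_val : Continuous fun g : G.Loop => g.1)
  ext g
  constructor
  · rintro ⟨y, hy, rfl⟩
    exact ⟨_, ⟨(y.1, A.rep q.1 q.2), ⟨hy, rfl⟩, rfl⟩, rfl⟩
  -- That the chart arrow of `(y, g)` is a loop says precisely that `g` fixes `y`.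
  · rintro ⟨_, ⟨⟨y, g'⟩, ⟨hy, rfl⟩, rfl⟩, e⟩
    have e' : ((A.chart q.1).arrow (y, A.rep q.1 q.2)).1 = g.1 := e
    refine ⟨⟨y, Subtype.ext ?_⟩, hy, Subtype.ext e⟩
    change G.tgt ((A.chart q.1).arrow (y, A.rep q.1 q.2)).1 = y
    rw [← (A.chart q.1).src_arrow y (A.rep q.1 q.2), e']
    exact g.2

/-- The square is cartesian because an arrow between two sector points is just an arrow of `G` that
conjugates their loops. The map in the second condition is surjective by `exists_conj_toLoop`, and
open as the base change of `toLoop` followed by the source map of the inertia groupoid. -/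
theorem isMorita_toInertia (hd : ∀ x, DiscreteTopology (G.Isotropy x)) (ho : IsOpenMap G.src) :
    A.toInertia.IsMorita where
  cartesian := by
    have hT := A.twistedSectors_isTopological
    rw [isHomeomorph_iff_exists_inverse]
    refine ⟨Continuous.subtype_mk ((hT.continuous_src.prodMk hT.continuous_tgt).prodMk
      A.toInertia.arr.continuous) _, fun p => ⟨(p.1.1.1, p.1.2.1.2.1, p.1.1.2), ?_⟩, ?_, ?_, ?_⟩
    · obtain ⟨⟨⟨y, y'⟩, ⟨⟨g, a, h⟩, H⟩⟩, h1, h2⟩ := p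
      obtain rfl : g = A.toLoop y := h1
      obtain rfl : h = A.toLoop y' := h2
      exact A.intertwines_iff.2 H
    · exact fun r => rfl
    · rintro ⟨⟨⟨y, y'⟩, ⟨⟨g, a, h⟩, H⟩⟩, h1, h2⟩
      obtain rfl : g = A.toLoop y := h1
      obtain rfl : h = A.toLoop y' := h2
      rfl
    · have h : Continuous fun p : {p : (A.SectorObj × A.SectorObj) × G.InertiaArr //
        p.2.1.1 = A.toLoop p.1.1 ∧ p.2.1.2.2 = A.toLoop p.1.2} => (p.1.1, p.1.2.1) := by fun_prop
      exact Continuous.subtype_mk (h.fst.fst.prodMk (h.snd.snd.fst.prodMk h.fst.snd)) _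
  surjective g := by
    obtain ⟨a, y, H⟩ := A.exists_conj_toLoop g
    exact ⟨⟨(y, ⟨(g, a, A.toLoop y), H⟩), rfl⟩, rfl⟩
  isOpenMap := (G.inertia_isOpenMap_src ho).comp
    ((A.isOpenMap_toLoop hd).pullback_snd G.inertia_isTopological.continuous_tgt)

end OrbifoldAtlas

end TGpd

namespace TGpd

/-! ### Existence of orbifold charts -/

section Charts

variable {G : TGpd.{u}}

/-- The source map is constant on an isotropy group and locally injective. -/
theorem discreteTopology_isotropy (hs : IsLocalHomeomorph G.src) (x : G.Obj) :
    DiscreteTopology (G.Isotropy x) := by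
  refine discreteTopology_iff_isOpen_singleton.2 fun g => ?_
  obtain ⟨e, he, hes⟩ := hs g.1
  convert e.open_source.preimage (continuous_subtype_val : Continuous fun g : G.Isotropy x => g.1)
  ext k
  refine ⟨fun h => ?_, fun h => Subtype.ext (e.injOn h he ?_)⟩
  · obtain rfl : k = g := h
    exact he
  · rw [← hes, k.2.1, g.2.1]

/-- The group is a fibre of the proper map `(s, t)`, hence compact, and it is discrete. -/
theorem finite_isotropy [T1Space G.Obj] (hs : IsLocalHomeomorph G.src)
    (hp : IsProperMap fun a : G.Arr => (G.src a, G.tgt a)) (x : G.Obj) :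
    Finite (G.Isotropy x) := by
  have := discreteTopology_isotropy hs x
  have hc : IsCompact {a : G.Arr | G.src a = x ∧ G.tgt a = x} := by
    convert hp.isCompact_preimage (isCompact_singleton (x := (x, x))) using 1
    ext a
    simp [Prod.ext_iff]
  have : CompactSpace (G.Isotropy x) := isCompact_iff_compactSpace.1 hc
  exact finite_of_compact_of_discrete

/-- Composition is continuous only on the subspace of composable pairs; this extracts neighbourhoods
of the two factors separately. -/
theorem comp_mem_of_mem_nhds [hG : G.IsTopological] {a b : G.Arr} (h : G.tgt a = G.src b)
    {O : Set G.Arr} (hO : O ∈ nhds (G.comp a b h)) : ∃ A ∈ nhds a, ∃ B ∈ nhds b,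
      ∀ a' ∈ A, ∀ b' ∈ B, ∀ h', G.comp a' b' h' ∈ O := by
  have h1 := (hG.continuous_comp.continuousAt (x := ⟨(a, b), h⟩)).preimage_mem_nhds hO
  obtain ⟨N, hN, hNs⟩ := mem_nhds_subtype _ _ _ |>.1 h1
  obtain ⟨A, hA, B, hB, hAB⟩ := mem_nhds_prod_iff.1 hN
  exact ⟨A, hA, B, hB, fun a' ha b' hb h' => hNs (show (⟨(a', b'), h'⟩ : {p : G.Arr × G.Arr //
    G.tgt p.1 = G.src p.2}) ∈ _ from hAB ⟨ha, hb⟩)⟩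

/-- The chart sends `(y, g)` to `σ g y`, where `σ g` is the local section of the source map through
the isotropy arrow `g`. The work lies in finding a connected open `V` that is invariant under all `f
g = t ∘ σ g`, on which the sections are multiplicative and over which they exhaust the arrows. -/
theorem exists_orbifoldChart [hG : G.IsTopological] [T1Space G.Obj] [T2Space G.Arr]
    [LocallyConnectedSpace G.Obj] (hs : IsLocalHomeomorph G.src)
    (hp : IsProperMap fun a : G.Arr => (G.src a, G.tgt a)) (x : G.Obj) :
    Nonempty (G.OrbifoldChart x) := by
  have hfin := finite_isotropy hs hp x
  have hdisc := discreteTopology_isotropy hs x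
  choose e he hes using fun g : G.Isotropy x => hs g.1
  have hes' : ∀ g a, e g a = G.src a := fun g a => (congrFun (hes g) a).symm
  obtain ⟨D, hD, hDd⟩ := (Set.finite_range (Subtype.val : G.Isotropy x → G.Arr)).t2_separation
  -- disjoint open neighbourhoods of the isotropy arrows on which the source is injective
  set W : G.Isotropy x → Set G.Arr := fun g => (e g).source ∩ D g.1 with hW
  have hWo : ∀ g, IsOpen (W g) := fun g => (e g).open_source.inter (hD _).2
  have hWm : ∀ g : G.Isotropy x, g.1 ∈ W g := fun g => ⟨he g, (hD _).1⟩
  have hWd : ∀ g k a, a ∈ W g → a ∈ W k → g = k := by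
    intro g k a hg hk
    by_contra hne
    exact Set.disjoint_left.1 (hDd ⟨g, rfl⟩ ⟨k, rfl⟩ fun h => hne (Subtype.ext h)) hg.2 hk.2
  set σ : G.Isotropy x → G.Obj → G.Arr := fun g => (e g).symm with hσ
  have hσx : ∀ g, σ g x = g.1 := fun g => by
    have := (e g).left_inv (he g)
    rwa [hes', g.2.1] at this
  have hxt : ∀ g, x ∈ (e g).target := fun g => by
    have := (e g).map_source (he g)
    rwa [hes', g.2.1] at this
  have hσs : ∀ g y, y ∈ (e g).target → G.src (σ g y) = y := fun g y hy => by
    rw [← hes' g]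
    exact (e g).right_inv hy
  have hσW : ∀ g a, a ∈ W g → a = σ g (G.src a) := fun g a ha => by
    rw [← hes' g]
    exact ((e g).left_inv ha.1).symm
  have hσc : ∀ g y, y ∈ (e g).target → ContinuousAt (σ g) y := fun g y hy =>
    (e g).symm.continuousAt hy
  set f : G.Isotropy x → G.Obj → G.Obj := fun g y => G.tgt (σ g y) with hf
  have hfc : ∀ g y, y ∈ (e g).target → ContinuousAt (f g) y := fun g y hy =>
    hG.continuous_tgt.continuousAt.comp (hσc g y hy)
  have hfx : ∀ g, f g x = x := fun g => by simp only [hf, hσx, g.2.2]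
  have hsx : ∀ g, ∀ N ∈ nhds g.1, ∀ᶠ y in nhds x, σ g y ∈ N := fun g N hN => by
    refine (hσc g x (hxt g)).eventually_mem ?_
    rwa [hσx]
  have hfn : ∀ g, ∀ N ∈ nhds x, ∀ᶠ y in nhds x, f g y ∈ N := fun g N hN => by
    refine (hfc g x (hxt g)).eventually_mem ?_
    rwa [hfx]
  -- arrows with both ends near `x` lie in one of these neighbourhoods
  obtain ⟨N, hN, hNW⟩ : ∃ N ∈ nhds x, ∀ a, G.src a ∈ N → G.tgt a ∈ N → ∃ g, a ∈ W g := by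
    -- A proper map is closed, so the arrows outside the union of the `W g` have closed image. It
    -- misses `(x, x)`, whose fibre is the isotropy group.
    have hcl := hp.isClosedMap _ (isOpen_iUnion hWo).isClosed_compl
    have hx : (x, x) ∉ (fun a : G.Arr => (G.src a, G.tgt a)) '' (⋃ g, W g)ᶜ := by
      rintro ⟨a, ha, hax⟩
      refine ha (Set.mem_iUnion.2 ⟨⟨a, (Prod.ext_iff.1 hax).1, (Prod.ext_iff.1 hax).2⟩, hWm ⟨a, _⟩⟩)
    obtain ⟨A, hA, B, hB, hAB⟩ := mem_nhds_prod_iff.1 (hcl.isOpen_compl.mem_nhds hx)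
    refine ⟨A ∩ B, Filter.inter_mem hA hB, fun a h1 h2 => ?_⟩
    by_contra hcon
    exact hAB (⟨h1.1, h2.2⟩ : (G.src a, G.tgt a) ∈ A ×ˢ B)
      ⟨a, fun h => hcon (Set.mem_iUnion.1 h), rfl⟩
  have hmul : ∀ g k : G.Isotropy x, ∃ A ∈ nhds g.1, ∃ B ∈ nhds k.1,
      ∀ a' ∈ A, ∀ b' ∈ B, ∀ h', G.comp a' b' h' ∈ W (g * k) := fun g k =>
    comp_mem_of_mem_nhds (g.2.2.trans k.2.1.symm) ((hWo _).mem_nhds (hWm (g * k)))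
  choose A hA B hB hAB using hmul
  -- a neighbourhood on which the local sections are multiplicative
  have hM : ∀ᶠ y in nhds x, y ∈ N ∧ ∀ g, y ∈ (e g).target ∧ σ g y ∈ W g ∧
      ∀ k, σ g y ∈ A g k ∧ f g y ∈ (e k).target ∧ σ k (f g y) ∈ B g k := by
    refine Filter.Eventually.and hN (Filter.eventually_all.2 fun g => ?_)
    refine Filter.Eventually.and ((e g).open_target.mem_nhds (hxt g))
      ((hsx g _ ((hWo g).mem_nhds (hWm g))).and (Filter.eventually_all.2 fun k => ?_))
    refine (hsx g _ (hA g k)).and ((hfn g _ ((e k).open_target.mem_nhds (hxt k))).and ?_)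
    exact hfn g _ (hsx k _ (hB g k))
  obtain ⟨U, hUM, hUo, hxU⟩ := mem_nhds_iff.1 hM
  have hfcU : ∀ g, ContinuousOn (f g) U := fun g y hy =>
    (hfc g y ((hUM hy).2 g).1).continuousWithinAt
  -- The points of `U` that every `f g` keeps in `U`. Multiplicativity of the sections makes this
  -- set invariant, and finiteness of the group makes it open.
  set V' : Set G.Obj := U ∩ ⋂ g, U ∩ f g ⁻¹' U with hV'
  have hV'o : IsOpen V' :=
    hUo.inter (isOpen_iInter_of_finite fun g => (hfcU g).isOpen_inter_preimage hUo hUo)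
  have hxV' : x ∈ V' := ⟨hxU, Set.mem_iInter.2 fun g => ⟨hxU, by
    change f g x ∈ U
    rwa [hfx]⟩⟩
  have hV'U : ∀ {y}, y ∈ V' → ∀ g, f g y ∈ U := fun hy g => (Set.mem_iInter.1 hy.2 g).2
  have hσm : ∀ y (hy : y ∈ V') g k, σ (g * k) y = G.comp (σ g y) (σ k (f g y))
      (hσs k _ (((hUM hy.1).2 g).2.2 k).2.1).symm := by
    intro y hy g k
    have h1 := ((hUM hy.1).2 g).2.2 k
    -- The composite lies in `W (g * k)`, where an arrow is determined by its source.
    have h2 := hσW _ _ (hAB g k _ h1.1 _ h1.2.2 (hσs k _ h1.2.1).symm)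
    rw [G.src_comp, hσs g y ((hUM hy.1).2 g).1] at h2
    exact h2.symm
  have hfm : ∀ y ∈ V', ∀ g k, f (g * k) y = f k (f g y) := fun y hy g k => by
    simp only [hf, hσm y hy g k, G.tgt_comp]
  have hfV' : ∀ g, Set.MapsTo (f g) V' V' := fun g y hy =>
    ⟨hV'U hy g, Set.mem_iInter.2 fun k => ⟨hV'U hy g, by
      change f k (f g y) ∈ U
      rw [← hfm y hy]
      exact hV'U hy _⟩⟩
  set V := connectedComponentIn V' x with hVdef
  have hVV' : V ⊆ V' := connectedComponentIn_subset _ _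
  have hxV : x ∈ V := mem_connectedComponentIn hxV'
  -- Each `f g` fixes `x`, so it maps the connected component of `x` into itself.
  have hfV : ∀ g, Set.MapsTo (f g) V V := fun g y hy => by
    have h1 := ((hfcU g).mono Set.inter_subset_left).image_connectedComponentIn_subset hxV'
      ⟨y, hy, rfl⟩
    rw [hfx] at h1
    exact connectedComponentIn_mono _ (hfV' g).image_subset h1
  have hσsV : ∀ g, ∀ y ∈ V, G.src (σ g y) = y := fun g y hy =>
    hσs g y ((hUM (hVV' hy).1).2 g).1
  -- The sheet `W g` containing an arrow over `V` is unique. Its label is the group coordinate of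
  -- the inverse of the chart, continuous because the sheets are open.
  have hk : ∀ a : {a : G.Arr // G.src a ∈ V ∧ G.tgt a ∈ V}, ∃ g, a.1 ∈ W g := fun a =>
    hNW _ (hUM (hVV' a.2.1).1).1 (hUM (hVV' a.2.2).1).1
  choose k hk using hk
  let arr : V × G.Isotropy x → {a : G.Arr // G.src a ∈ V ∧ G.tgt a ∈ V} := fun p =>
    ⟨σ p.2 p.1, by rw [hσsV _ _ p.1.2]; exact p.1.2, hfV p.2 p.1.2⟩
  have harr : IsHomeomorph arr := by
    rw [isHomeomorph_iff_exists_inverse]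
    refine ⟨Continuous.subtype_mk ?_ _, fun a => (⟨G.src a.1, a.2.1⟩, k a), ?_, ?_, ?_⟩
    · refine continuous_prod_of_discrete_right.2 fun g => ?_
      refine continuous_iff_continuousAt.2 fun y => ?_
      exact (hσc g y ((hUM (hVV' y.2).1).2 g).1).comp continuous_subtype_val.continuousAt
    · rintro ⟨y, g⟩
      refine Prod.ext (Subtype.ext (hσsV _ _ y.2)) (hWd _ _ _ (hk _) ?_)
      exact ((hUM (hVV' y.2).1).2 g).2.1
    · exact fun a => Subtype.ext (hσW _ _ (hk a)).symm
    · refine Continuous.prodMk ((hG.continuous_src.comp continuous_subtype_val).subtype_mk _)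
        (continuous_discrete_rng.2 fun g => ?_)
      convert (hWo g).preimage (continuous_subtype_val :
        Continuous fun a : {a : G.Arr // G.src a ∈ V ∧ G.tgt a ∈ V} => a.1)
      ext a
      refine ⟨fun h => ?_, fun h => hWd _ _ _ (hk a) h⟩
      obtain rfl : k a = g := h
      exact hk a
  exact ⟨{
    V := V
    isOpen := hV'o.connectedComponentIn
    isConnected := isConnected_connectedComponentIn_iff.2 hxV'
    mem := hxV
    arrow := harr.homeomorph
    src_arrow := fun y g => hσsV g y y.2
    arrow_base := fun g => hσx g
    arrow_mul := fun y g k => hσm y (hVV' y.2) g k }⟩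

/-- A groupoid with an orbifold chart at every object has an orbifold atlas. -/
theorem nonempty_orbifoldAtlas (h : ∀ x, Nonempty (G.OrbifoldChart x)) :
    Nonempty G.OrbifoldAtlas :=
  ⟨{ pt := Quotient.out
     pt_eq := Quotient.out_eq
     chart := fun _ => (h _).some
     rep := fun _ => Quotient.out
     rep_eq := fun _ => Quotient.out_eq }⟩

end Charts

end TGpd

namespace CircleCover

/-! ### Rotation invariant functions on the groupoid of a cover -/

/-- For every real number there is a greatest lift strictly below it. -/
theorem exists_pred (W : CircleCover) (x : ℝ) :
    ∃ a : W.Index, a.val < x ∧ ∀ b : W.Index, b.val < x → b.val ≤ a.val := by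
  -- Each point has exactly one lift in `[x - 1, x)`. Excluding `x` gives the strict inequality, in
  -- contrast to the interval used for `exists_floor`.
  obtain ⟨q, hq, hmax⟩ := Set.exists_max_image W.pts
    (fun q => ((AddCircle.equivIco (1 : ℝ) (x - 1) q : Set.Ico (x - 1) (x - 1 + 1)) : ℝ))
    W.finite W.nonempty
  have hcoe : ∀ q : UnitAddCircle,
      (((AddCircle.equivIco (1 : ℝ) (x - 1) q : Set.Ico (x - 1) (x - 1 + 1)) : ℝ) :
        UnitAddCircle) = q := fun q => (AddCircle.equivIco (1 : ℝ) (x - 1)).symm_apply_apply q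
  refine ⟨⟨_, by rw [hcoe q]; exact hq⟩, ?_, fun b hb => ?_⟩
  · have := (AddCircle.equivIco (1 : ℝ) (x - 1) q).2.2
    simp only
    linarith
  · rcases lt_or_ge b.val (x - 1) with h | h
    · exact h.le.trans (AddCircle.equivIco (1 : ℝ) (x - 1) q).2.1
    · have h1 := hmax _ b.mem
      have h2 := congrArg Subtype.val ((AddCircle.equivIco (1 : ℝ) (x - 1)).apply_symm_apply
        ⟨b.val, h, by linarith⟩)
      exact h2.symm.le.trans h1

/-- For every real number there is a least lift strictly above it. -/
theorem exists_succ (W : CircleCover) (x : ℝ) :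
    ∃ a : W.Index, x < a.val ∧ ∀ b : W.Index, x < b.val → a.val ≤ b.val := by
  -- Each point has exactly one lift in `(x, x + 1]`, again leaving out `x`.
  obtain ⟨q, hq, hmin⟩ := Set.exists_min_image W.pts
    (fun q => ((AddCircle.equivIoc (1 : ℝ) x q : Set.Ioc x (x + 1)) : ℝ))
    W.finite W.nonempty
  have hcoe : ∀ q : UnitAddCircle,
      (((AddCircle.equivIoc (1 : ℝ) x q : Set.Ioc x (x + 1)) : ℝ) :
        UnitAddCircle) = q := fun q => (AddCircle.equivIoc (1 : ℝ) x).symm_apply_apply q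
  refine ⟨⟨_, by rw [hcoe q]; exact hq⟩, (AddCircle.equivIoc (1 : ℝ) x q).2.1, fun b hb => ?_⟩
  rcases lt_or_ge (x + 1) b.val with h | h
  · exact (AddCircle.equivIoc (1 : ℝ) x q).2.2.trans h.le
  · have h1 := hmin _ b.mem
    have h2 := congrArg Subtype.val ((AddCircle.equivIoc (1 : ℝ) x).apply_symm_apply
      ⟨b.val, hb, h⟩)
    exact h1.trans h2.le

/-- Distinct points of an admissible cover are at distance at least `2 ε`. -/
theorem two_mul_ε_le (W : CircleCover) {b c : W.Index} (h : b.val < c.val) :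
    2 * W.ε ≤ c.val - b.val := by
  by_contra! hlt
  obtain ⟨a, ha, ha'⟩ := W.exists_pred b.val
  obtain ⟨d, hd, hd'⟩ := W.exists_succ b.val
  have hdc := hd' c h
  have hε := W.ε_pos
  -- If the gap after `b` were less than `2 ε`, the midpoint of `b` and its successor `d` would lie
  -- in the intervals of the predecessor `a`, of `b` and of `d`.
  refine (Set.eq_empty_iff_forall_notMem.1
    (W.admissible a.val b.val d.val a.mem b.mem d.mem ha hd)) ((b.val + d.val) / 2)
    ⟨⟨⟨by linarith, fun e he hae => ?_⟩, by linarith, fun e he hbe => ?_⟩,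
      by linarith, fun e he hde => by linarith⟩
  · have : b.val ≤ e := by
      by_contra! hcon
      exact absurd (ha' ⟨e, he⟩ hcon) (not_le.2 hae)
    linarith
  · have : d.val ≤ e := hd' ⟨e, he⟩ hbe
    linarith

/-- The cover with the same points and a smaller `ε`. -/
def shrink (W : CircleCover) (ε : ℝ) (h0 : 0 < ε) (h : ε ≤ W.ε) : CircleCover where
  pts := W.pts
  finite := W.finite
  nonempty := W.nonempty
  ε := ε
  ε_pos := h0
  admissible a b c ha hb hc hab hbc := by
    have key : ∀ d, coverInterval W.pts ε d ⊆ coverInterval W.pts W.ε d := fun d x hx =>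
      ⟨by linarith [hx.1], fun e he hde => by linarith [hx.2 e he hde]⟩
    exact Set.subset_eq_empty (Set.inter_subset_inter (Set.inter_subset_inter (key a) (key b))
      (key c)) (W.admissible a b c ha hb hc hab hbc)

theorem mem_interval_floor_self (W : CircleCover) (x : ℝ) : x ∈ W.interval (W.floor x) := by
  refine ⟨by linarith [W.floor_le x, W.ε_pos], fun b hb h => ?_⟩
  by_contra! hcon
  have hε := W.ε_pos
  exact absurd (W.le_floor (b := ⟨b, hb⟩) (by simp only; linarith)) (not_le.2 h)

/-- The arrow over `x` from the chart of the nearest point on the left of `x` to its translate. -/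
noncomputable def baseArr (W : CircleCover) (x : ℝ) (l : ℤ) : W.circle.Arr :=
  ⟨((x, W.floor x, W.floor x), l), W.mem_interval_floor_self x, W.mem_interval_floor_self x⟩

/-- Taking the nearest point on the left in two stages, first for the finer cover, gives the same
result as in one. Hence evaluation at `baseArr x l` is compatible with refinement and descends to
the colimit. -/
theorem refineHom_baseArr {W W' : CircleCover} (h : W ≤ W') (x : ℝ) (l : ℤ) :
    (refineHom h).arr (W'.baseArr x l) = W.baseArr x l :=
  Subtype.ext (Prod.ext (Prod.ext rfl (Prod.ext (floor_floor h x) (floor_floor h x))) rfl)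

theorem unrotate_floor (W : CircleCover) (z x : ℝ) :
    ((W.rotate z).floor x).unrotate = W.floor (x - z) := by
  refine (W.floor_eq (sub_le_sub_right ((W.rotate z).floor_le x) z) fun b hb => ?_).symm
  have := (W.rotate z).le_floor (x := x)
    (b := ⟨b.val + z, by change _ - _ ∈ W.pts; simpa [AddCircle.coe_add] using b.mem⟩)
    (by simp only; linarith)
  change b.val ≤ _ - z
  simp only at this
  linarith

/-- There is a rotation that moves all points of a cover off the points of the cover. -/
theorem exists_rotate_disjoint (W : CircleCover) :
    ∃ z : ℝ, ∀ a c : W.Index, a.val ≠ c.val + z := by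
  have : Infinite UnitAddCircle := by
    have : Infinite (Set.Ico (0 : ℝ) (0 + 1)) := Set.infinite_coe_iff.2 (Set.Ico_infinite (by simp))
    exact Infinite.of_injective _ (AddCircle.equivIco (1 : ℝ) 0).symm.injective
  -- The rotations to avoid are the differences of two points of the cover, finitely many in an
  -- infinite circle.
  obtain ⟨w, hw⟩ := (W.finite.image2 (fun p q => p - q) W.finite).exists_notMem
  obtain ⟨z, rfl⟩ := QuotientAddGroup.mk_surjective w
  refine ⟨z, fun a c h => hw ⟨_, a.mem, _, c.mem, ?_⟩⟩
  rw [h, AddCircle.coe_add]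
  exact add_sub_cancel_left _ _

/-- Let `W''` refine `W` and its translate by a generic `z`. A point of an interval of `W`, shrunk
to the `ε` of `W''`, lies in an interval of `W''` contained in it which, translated back,
lies in the interval of `W` whose left end point is nearest. -/
theorem exists_index_of_rotate {W W'' : CircleCover} {z : ℝ} (h : W ≤ W'')
    (hz : W.rotate z ≤ W'') (hd : ∀ a c : W.Index, a.val ≠ c.val + z) {a : W.Index} {x : ℝ}
    (hx : x ∈ coverInterval W.pts W''.ε a.val) :
    ∃ a'' : W''.Index, x ∈ W''.interval a'' ∧ W.floor a''.val = a ∧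
      W.floor (a''.val - z) = W.floor (x - z) := by
  have hε := W''.ε_pos
  let up : W.Index → W''.Index := fun c => ⟨c.val + z, hz.1 (by
    change _ - _ ∈ W.pts; simpa [AddCircle.coe_add] using c.mem)⟩
  have hup : ∀ c, (up c).val = c.val + z := fun _ => rfl
  have hup' : ∀ c b : W.Index, (up c).val ≠ b.val := fun c b e => hd b c e.symm
  rcases lt_or_ge x a.val with hxa | hxa
  -- Left overlap, `a - ε'' < x < a`: the point `a` itself serves. A translated point between `x`
  -- and `a` would differ from `a`, by genericity, yet be closer than `2 ε''`.
  · refine ⟨⟨a.val, h.1 a.mem⟩, ⟨hx.1, fun b _ hb => by simp only at hb; linarith⟩,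
      W.floor_val a, (W.floor_eq ?_ fun b hb => W.le_floor (by simp only; linarith)).symm⟩
    set c := W.floor (a.val - z) with hc
    have hca : c.val ≤ a.val - z := W.floor_le _
    by_contra! hcon
    have h1 : (up c).val < a.val := lt_of_le_of_ne (by rw [hup]; linarith) (hup' c a)
    have h2 := W''.two_mul_ε_le (b := up c) (c := ⟨a.val, h.1 a.mem⟩) h1
    have h3 := hx.1
    simp only [hup] at h2
    linarith
  obtain ⟨s, hs, hs'⟩ := W.exists_succ a.val
  rcases lt_or_ge x s.val with hxs | hxs
  -- No overlap, `a ≤ x < s`: the nearest point of `W''` on the left of `x` serves.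
  · refine ⟨W''.floor x, W''.mem_interval_floor_self x, ?_, ?_⟩
    · rw [floor_floor h]
      refine W.floor_eq hxa fun b hb => ?_
      by_contra! hcon
      linarith [hs' b hcon]
    · refine W.floor_eq ?_ fun b hb => W.le_floor (by linarith [W''.floor_le x])
      have h1 := W.floor_le (x - z)
      have h2 := W''.le_floor (x := x) (b := up (W.floor (x - z))) (by rw [hup]; linarith)
      rw [hup] at h2
      linarith
  -- Right overlap, `s ≤ x < s + ε''`: the point of `W''` just before `s` serves, as its interval
  -- reaches to `s + ε''`. A translated point after `p` and up to `x` would be at least `s`, differ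
  -- from it, and lie within `ε''` of it.
  · obtain ⟨p, hp, hp'⟩ := W''.exists_pred s.val
    have hap : a.val ≤ p.val := hp' ⟨a.val, h.1 a.mem⟩ hs
    have hxs' := hx.2 s.val s.mem hs
    refine ⟨p, ⟨by linarith, fun b hbm hb => ?_⟩, W.floor_eq hap fun b hb => ?_,
      W.floor_eq ?_ fun b hb => W.le_floor (by linarith)⟩
    · have : s.val ≤ b := by
        by_contra! hcon
        exact absurd (hp' ⟨b, hbm⟩ hcon) (not_le.2 hb)
      linarith
    · by_contra! hcon
      linarith [hs' b hcon]
    · have h1 := W.floor_le (x - z)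
      set c := W.floor (x - z)
      by_contra! hcon
      have h2 : s.val ≤ (up c).val := by
        by_contra! hlt
        have := hp' _ hlt
        rw [hup] at this
        linarith
      have h3 := W''.two_mul_ε_le (b := ⟨s.val, h.1 s.mem⟩) (c := up c)
        (lt_of_le_of_ne h2 (hup' c s).symm)
      simp only [hup] at h3
      linarith

/-- A function on the arrows of the groupoid of a cover that is invariant under all rotations, up
to refinement, depends after refinement only on the winding number of the arrow. -/
theorem exists_refinement_eq_baseArr {X : Type*} {W : CircleCover} {φ : W.circle.Arr → X}
    (hφ : ∀ z, ∃ (W'' : CircleCover) (hz : W.rotate z ≤ W'') (h : W ≤ W''), ∀ r,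
      φ ((W.unrotateHom z).arr ((refineHom hz).arr r)) = φ ((refineHom h).arr r)) :
    ∃ (W' : CircleCover) (h : W ≤ W'), ∀ r, φ ((refineHom h).arr r) = φ (W.baseArr 0 r.1.2) := by
  -- Rotation by `x` itself carries the base arrow at `x` to the one at `0`, and base arrows survive
  -- refinement, so whichever `W''` occurs does not matter.
  have hbase : ∀ x l, φ (W.baseArr x l) = φ (W.baseArr 0 l) := fun x l => by
    obtain ⟨W'', hz, h, H⟩ := hφ x
    have h1 := H (W''.baseArr x l)
    rw [refineHom_baseArr, refineHom_baseArr] at h1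
    rw [← h1]
    have h2 : ((W.rotate x).floor x).unrotate = W.floor 0 := by rw [unrotate_floor, sub_self]
    exact congrArg φ (Subtype.ext (Prod.ext (Prod.ext (sub_self x) (Prod.ext h2 h2)) rfl))
  obtain ⟨z, hd⟩ := W.exists_rotate_disjoint
  obtain ⟨W'', hz, h, H⟩ := hφ z
  -- The refinement keeps the points of `W` and borrows only the `ε` of `W''`, so its intervals are
  -- those to which `exists_index_of_rotate` applies.
  refine ⟨W.shrink W''.ε W''.ε_pos h.2, ⟨subset_rfl, h.2⟩, ?_⟩
  rintro ⟨⟨⟨x, a, b⟩, l⟩, hxa, hxb⟩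
  obtain ⟨a', ha1, ha2, ha3⟩ := exists_index_of_rotate h hz hd (a := ⟨a.val, a.mem⟩) hxa
  obtain ⟨b', hb1, hb2, hb3⟩ := exists_index_of_rotate h hz hd (a := ⟨b.val, b.mem⟩) hxb
  -- This arrow of `W''` refines to `(x, a, b, l)` in `W`; rotated back, both of its charts become
  -- the floor of `x - z`, so it becomes a base arrow.
  have h1 := H ⟨((x, a', b'), l), ha1, hb1⟩
  rw [← hbase (x - z)]
  refine Eq.trans (congrArg φ (Subtype.ext ?_)) (h1.symm.trans (congrArg φ (Subtype.ext ?_)))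
  · exact Prod.ext (Prod.ext rfl (Prod.ext ((W.floor_val _).trans ha2.symm)
      ((W.floor_val _).trans hb2.symm))) rfl
  · exact Prod.ext (Prod.ext rfl (Prod.ext ((W.unrotate_floor z _).trans ha3)
      ((W.unrotate_floor z _).trans hb3))) rfl

/-- The cover of the circle with a single point. -/
noncomputable def basic : CircleCover where
  pts := {0}
  finite := Set.finite_singleton _
  nonempty := Set.singleton_nonempty _
  ε := 1 / 2
  ε_pos := by norm_num
  admissible a b c ha hb hc hab hbc := by
    -- All lifts are integers. An interval whose left point is at least two beyond that of another
    -- is disjoint from it as soon as `ε ≤ 1 / 2`.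
    refine Set.eq_empty_of_forall_notMem fun x hx => ?_
    have h1 := hx.2.1
    have h2 := hx.1.1.2 b hb hab
    obtain ⟨m, hm⟩ := (AddCircle.coe_eq_zero_iff (p := (1 : ℝ))).1 hb
    obtain ⟨n, hn⟩ := (AddCircle.coe_eq_zero_iff (p := (1 : ℝ))).1 hc
    simp only [zsmul_eq_mul, mul_one] at hm hn
    have h3 : m + 1 ≤ n := by
      have : (m : ℝ) < n := by rw [hm, hn]; exact hbc
      exact_mod_cast this
    have h4 : (m : ℝ) + 1 ≤ n := by exact_mod_cast h3
    linarith

end CircleCover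

namespace TGpd

/-! ### Constant loops -/

/-! ### Integer powers of loops -/

section Power

variable {G : TGpd.{u}}

/-- The pairs of isotropy elements intertwined by an arrow. -/
def intertwiner (a : G.Arr) : Subgroup (G.Isotropy (G.src a) × G.Isotropy (G.tgt a)) where
  carrier := {k | G.comp k.1.1 a k.1.2.2 = G.comp a k.2.1 k.2.2.1.symm}
  one_mem' := (G.unit_comp_of _).trans (G.comp_unit_of _).symm
  mul_mem' {k m} hk hm := by
    change G.comp (G.comp k.1.1 m.1.1 _) a _ = G.comp a (G.comp k.2.1 m.2.1 _) _
    rw [G.assoc _ _ _ _ m.1.2.2, G.comp_congr rfl hm, ← G.assoc _ _ _ k.1.2.2,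
      G.comp_congr hk rfl, G.assoc]
  inv_mem' {k} hk := by
    change G.comp (G.inv k.1.1) a _ = G.comp a (G.inv k.2.1) _
    have h0 : G.tgt (G.comp k.1.1 a k.1.2.2) = G.src (G.inv k.2.1) := by simp [k.2.2.2]
    have h1 : G.comp (G.comp k.1.1 a k.1.2.2) (G.inv k.2.1) h0 = a := by
      rw [G.comp_congr hk rfl, G.assoc _ _ _ _ (by simp), G.comp_congr rfl (G.comp_inv _)]
      exact G.comp_unit_of _
    have h2 : G.tgt (G.inv k.1.1) = G.src (G.comp (G.comp k.1.1 a k.1.2.2) (G.inv k.2.1) h0) := by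
      simp
    rw [G.comp_congr rfl h1.symm, G.comp_congr rfl (G.assoc _ _ _ _ _)]
    exact G.inv_comp_cancel _ _

/-- The powers of a loop. -/
def Loop.pow (g : G.Loop) (l : ℤ) : G.Arr := ((⟨g.1, rfl, g.2⟩ : G.Isotropy (G.src g.1)) ^ l).1

@[simp]
theorem Loop.src_pow (g : G.Loop) (l : ℤ) : G.src (g.pow l) = G.src g.1 :=
  ((⟨g.1, rfl, g.2⟩ : G.Isotropy (G.src g.1)) ^ l).2.1

@[simp]
theorem Loop.tgt_pow (g : G.Loop) (l : ℤ) : G.tgt (g.pow l) = G.src g.1 :=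
  ((⟨g.1, rfl, g.2⟩ : G.Isotropy (G.src g.1)) ^ l).2.2

theorem Loop.pow_zero (g : G.Loop) : g.pow 0 = G.unit (G.src g.1) :=
  congrArg Subtype.val (zpow_zero (⟨g.1, rfl, g.2⟩ : G.Isotropy (G.src g.1)))

theorem Loop.pow_one (g : G.Loop) : g.pow 1 = g.1 :=
  congrArg Subtype.val (zpow_one (⟨g.1, rfl, g.2⟩ : G.Isotropy (G.src g.1)))

theorem Loop.pow_add (g : G.Loop) (l m : ℤ) :
    g.pow (l + m) = G.comp (g.pow l) (g.pow m) (by simp) :=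
  congrArg Subtype.val (zpow_add (⟨g.1, rfl, g.2⟩ : G.Isotropy (G.src g.1)) l m)

theorem Loop.pow_neg (g : G.Loop) (l : ℤ) : g.pow (-l) = G.inv (g.pow l) :=
  congrArg Subtype.val (zpow_neg (⟨g.1, rfl, g.2⟩ : G.Isotropy (G.src g.1)) l)

/-- `Loop.pow` computes in the isotropy group at the source of the loop, which equals the group at
`x` only up to a propositional equality of base points. -/
theorem Loop.pow_of_isotropy {x : G.Obj} (k : G.Isotropy x) (l : ℤ) :
    Loop.pow ⟨k.1, k.2.2.trans k.2.1.symm⟩ l = (k ^ l).1 := by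
  obtain ⟨a, rfl, h⟩ := k
  rfl

/-- The pairs intertwined by `a` form a subgroup of the product of the two isotropy groups, so with
`(g, h)` it contains all powers, negative ones included. -/
theorem Loop.Conj.pow {g h : G.Loop} {a : G.Arr} (H : g.Conj a h) (l : ℤ) :
    G.comp (g.pow l) a (by simp [H.1]) = G.comp a (h.pow l) (by simp [H.2.1]) := by
  obtain ⟨hs, ht, e⟩ := H
  have h1 := (intertwiner a).zpow_mem (x := (⟨g.1, hs.symm, g.2.trans hs.symm⟩,
    ⟨h.1, ht.symm, h.2.trans ht.symm⟩)) e l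
  refine (G.comp_congr (Loop.pow_of_isotropy ⟨g.1, hs.symm, g.2.trans hs.symm⟩ l) rfl _).trans
    (Eq.trans h1 (G.comp_congr rfl
      (Loop.pow_of_isotropy ⟨h.1, ht.symm, h.2.trans ht.symm⟩ l).symm _))

/-- The isotropy group varies with the loop, so continuity comes from the structure maps of `G`:
induction for natural exponents, then inversion. -/
theorem Loop.continuous_pow [hG : G.IsTopological] (l : ℤ) :
    Continuous fun g : G.Loop => g.pow l := by
  have hn : ∀ n : ℕ, Continuous fun g : G.Loop => g.pow n := by
    intro n
    induction n with
    | zero =>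
      refine (hG.continuous_unit.comp (hG.continuous_src.comp continuous_subtype_val)).congr ?_
      exact fun g => (Loop.pow_zero g).symm
    | succ n ih =>
      refine (G.continuous_comp_of ih continuous_subtype_val fun g => by simp).congr fun g => ?_
      push_cast
      rw [g.pow_add, G.comp_congr rfl g.pow_one]
  obtain ⟨n, rfl | rfl⟩ := l.eq_nat_or_neg
  · exact hn n
  · exact (hG.continuous_inv.comp (hn n)).congr fun g => (g.pow_neg _).symm

end Power

/-! ### Constant loops and constant arrows between them -/

section Constant

variable {G : TGpd.{u}}

/-- The constant loop at the object underlying `g`, with holonomy `g`. -/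
def constHom (W : CircleCover) (g : G.Loop) : Hom W.circle G where
  obj := ContinuousMap.const _ (G.src g.1)
  arr := ⟨fun r => g.pow r.1.2,
    (continuous_of_discreteTopology (f := g.pow)).comp (continuous_snd.comp continuous_subtype_val)⟩
  src_arr _ := g.src_pow _
  tgt_arr _ := g.tgt_pow _
  arr_unit _ := g.pow_zero
  arr_comp _ _ _ := g.pow_add _ _

/-- A constant loop sees only winding numbers, which both the refinement and the rotation morphisms
preserve; the lemma serves for both. -/
theorem trans_constHom {W W' : CircleCover} (E : Hom W'.circle W.circle)
    (hE : ∀ r, (E.arr r).1.2 = r.1.2) (g : G.Loop) :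
    E.trans (constHom W g) = constHom W' g :=
  Hom.ext' (fun _ => rfl) fun r => congrArg g.pow (hE r)

/-- A morphism on the groupoid of a cover whose values on arrows depend only on the winding
number is a constant loop. -/
theorem exists_eq_constHom {W : CircleCover} (F : Hom W.circle G) (c : ℤ → G.Arr)
    (h : ∀ r, F.arr r = c r.1.2) : ∃ g : G.Loop, F = constHom W g := by
  have hobj : ∀ p, F.obj p = G.src (c 0) := fun p => by
    have h1 : F.arr (W.circle.unit p) = c 0 := h _
    rw [← h1, F.src_arr, W.circle.src_unit]
  have hs : ∀ l, G.src (c l) = G.src (c 0) := fun l => by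
    have h1 : F.arr (W.baseArr 0 l) = c l := h _
    rw [← h1, F.src_arr, hobj]
  have ht : ∀ l, G.tgt (c l) = G.src (c 0) := fun l => by
    have h1 : F.arr (W.baseArr 0 l) = c l := h _
    rw [← h1, F.tgt_arr, hobj]
  -- Composing an arrow of winding number `l` with one of winding number `m` that starts at its
  -- target shows that `c` is a homomorphism, hence determined by its value at `1`.
  let f : Multiplicative ℤ →* G.Isotropy (G.src (c 0)) :=
    MonoidHom.mk' (fun l => ⟨c l.toAdd, hs _, ht _⟩) fun l m => Subtype.ext (by
      let r := W.baseArr 0 l.toAdd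
      let r' : W.circle.Arr := ⟨(((W.circle.tgt r).1.1, (W.circle.tgt r).1.2,
        (W.circle.tgt r).1.2), m.toAdd), (W.circle.tgt r).2, (W.circle.tgt r).2⟩
      have h1 := F.arr_comp r r' rfl
      rw [h] at h1
      exact h1.trans (G.comp_congr (h r) (h r') _))
  let k := f (Multiplicative.ofAdd 1)
  have hk : ∀ l : ℤ, c l = (k ^ l).1 := fun l =>
    congrArg Subtype.val (f.apply_mint _ (Multiplicative.ofAdd l))
  refine ⟨⟨k.1, k.2.2.trans k.2.1.symm⟩, Hom.ext' (fun p => ?_) fun r => ?_⟩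
  · exact (hobj p).trans (hs 1).symm
  · exact (h r).trans ((hk _).trans (Loop.pow_of_isotropy k _).symm)

variable [hG : G.IsTopological]

/-- The constant arrow between constant loops. -/
def constArr (W : CircleCover) (r : G.InertiaArr) : MapArr W.circle G :=
  MapArr.ofUnits (constHom W r.1.1) (constHom W r.1.2.2) (fun _ => r.1.2.1) continuous_const
    (fun _ => r.2.1) (fun _ => r.2.2.1) fun s => r.2.pow s.1.2

theorem constArr_app_unit (W : CircleCover) (r : G.InertiaArr) (p : W.circle.Obj) :
    (constArr W r).app (W.circle.unit p) = r.1.2.1 :=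
  MapArr.ofUnits_app_unit _ _ _ _ _ _ _ p

theorem precomp_constArr {W W' : CircleCover} (E : Hom W'.circle W.circle)
    (hE : ∀ r, (E.arr r).1.2 = r.1.2) (r : G.InertiaArr) :
    (constArr W r).precomp E = constArr W' r := by
  refine MapArr.ext_unit (trans_constHom E hE _) (trans_constHom E hE _) fun p => ?_
  rw [constArr_app_unit]
  change (constArr W r).app (E.arr _) = _
  rw [E.arr_unit, constArr_app_unit]

/-- The components on units all equal `e 0`, and naturality at an arrow of winding number one says
that `e 0` conjugates the holonomy of the source to that of the target. -/
theorem exists_eq_constArr {W : CircleCover} (L : MapArr W.circle G) (c d e : ℤ → G.Arr)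
    (hc : ∀ r, L.dom.arr r = c r.1.2) (hd : ∀ r, L.cod.arr r = d r.1.2)
    (he : ∀ r, L.app r = e r.1.2) : ∃ r : G.InertiaArr, L = constArr W r := by
  obtain ⟨g, hg⟩ := exists_eq_constHom L.dom c hc
  obtain ⟨h, hh⟩ := exists_eq_constHom L.cod d hd
  have hu : ∀ p, L.app (W.circle.unit p) = e 0 := fun p => he _
  let s := W.baseArr 0 1
  have h1 : G.src (e 0) = G.src g.1 := by
    rw [← hu (W.circle.src s), L.src_app, hg]
    rfl
  have h2 : G.tgt (e 0) = G.src h.1 := by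
    rw [← hu (W.circle.src s), L.tgt_app, hh]
    rfl
  have hgs : L.dom.arr s = g.1 := by
    rw [hg]
    exact g.pow_one
  have hhs : L.cod.arr s = h.1 := by
    rw [hh]
    exact h.pow_one
  have h3 := L.naturality s
  rw [G.comp_congr hgs (hu _), G.comp_congr (hu _) hhs] at h3
  refine ⟨⟨(g, e 0, h), h1, h2, h3⟩, MapArr.ext_unit hg hh fun p => ?_⟩
  rw [hu, constArr_app_unit]

/-- By currying, it suffices that `(g, l) ↦ g ^ l` is jointly continuous; the exponents being
discrete, this is continuity of each power. -/
theorem continuous_constHom (W : CircleCover) : Continuous (constHom (G := G) W) := by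
  refine continuous_induced_rng.2 (Continuous.prodMk ?_ ?_)
  · refine ContinuousMap.continuous_of_continuous_uncurry _ ?_
    exact hG.continuous_src.comp (continuous_subtype_val.comp continuous_fst)
  · refine ContinuousMap.continuous_of_continuous_uncurry _ ?_
    have h : Continuous fun p : G.Loop × ℤ => p.1.pow p.2 :=
      continuous_prod_of_discrete_right.2 fun l => Loop.continuous_pow l
    exact h.comp (continuous_fst.prodMk
      (continuous_snd.comp (continuous_subtype_val.comp continuous_snd)))

theorem continuous_constArr (W : CircleCover) : Continuous (constArr (G := G) W) := by
  refine continuous_induced_rng.2 (Continuous.prodMk ?_ ?_)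
  · exact (continuous_snd.comp (Hom.continuous_pair _ _)).comp
      ((continuous_constHom W).comp (continuous_fst.comp continuous_subtype_val))
  · refine ContinuousMap.continuous_of_continuous_uncurry _ ?_
    have h : Continuous fun p : G.InertiaArr × W.circle.Obj => p.1.1.2.1 := by fun_prop
    exact h.congr fun p => (constArr_app_unit W p.1 p.2).symm

variable (G)

/-- The inclusion of constant loops. -/
def constLoops (W : CircleCover) : Hom G.inertia (mapGpd W.circle G) where
  obj := ⟨constHom W, continuous_constHom W⟩
  arr := ⟨constArr W, continuous_constArr W⟩
  src_arr _ := rfl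
  tgt_arr _ := rfl
  arr_unit g := MapArr.ext_unit rfl rfl fun p => by
    refine (constArr_app_unit W _ p).trans ?_
    exact g.pow_zero.symm
  arr_comp r r' h := by
    obtain ⟨⟨x, a, y⟩, hr⟩ := r
    obtain ⟨⟨y', b, z⟩, hr'⟩ := r'
    obtain rfl : y = y' := h
    refine MapArr.ext_unit rfl rfl fun p => ?_
    refine (constArr_app_unit W _ p).trans (Eq.trans ?_ (MapArr.mul_app_unit _ _ rfl p).symm)
    exact (G.comp_congr (constArr_app_unit W _ p) (constArr_app_unit W _ p) _).symm

end Constant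

/-! ### Fixed loops are constant -/

/-- A morphism with values in the fixed objects and arrows of a family of endomorphisms. -/
def Hom.toFixed {H : TGpd.{v}} {G : TGpd.{u}} {Z : Type*} {T : Z → Hom G G} (F : Hom H G)
    (h0 : ∀ x z, (T z).obj (F.obj x) = F.obj x) (h1 : ∀ a z, (T z).arr (F.arr a) = F.arr a) :
    Hom H (G.fixedGpd T) where
  obj := ⟨fun x => ⟨F.obj x, h0 x⟩, F.obj.continuous.subtype_mk _⟩
  arr := ⟨fun a => ⟨F.arr a, h1 a⟩, F.arr.continuous.subtype_mk _⟩
  src_arr a := Subtype.ext (F.src_arr a)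
  tgt_arr a := Subtype.ext (F.tgt_arr a)
  arr_unit x := Subtype.ext (F.arr_unit x)
  arr_comp a b h := Subtype.ext (F.arr_comp a b h)

/-- A continuous surjection with a continuous map on its target such that the composition is an
embedding is a homeomorphism. -/
theorem _root_.IsHomeomorph.of_isEmbedding_comp {X Y Z : Type*} [TopologicalSpace X]
    [TopologicalSpace Y] [TopologicalSpace Z] {f : X → Y} {g : Y → Z} (hf : Continuous f)
    (hg : Continuous g) (hs : Function.Surjective f) (h : Topology.IsEmbedding (g ∘ f)) :
    IsHomeomorph f :=
  isHomeomorph_iff_isEmbedding_surjective.2 ⟨.of_comp hf hg h, hs⟩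

section FixedLoops

variable (G : TGpd.{u}) [hG : G.IsTopological]

open CircleCover (basic refineHom)

/-- Both become the same constant loop on a common refinement. Rotating a constant loop changes only
its cover, so this is what makes constant loops fixed points. -/
theorem mkObj_constHom (W W' : CircleCover) (g : G.Loop) :
    G.loopSystem.mkObj W (constHom W g) = G.loopSystem.mkObj W' (constHom W' g) := by
  obtain ⟨W'', h, h'⟩ := exists_ge_ge W W'
  refine G.loopSystem.mkObj_eq_iff.2 ⟨W'', h, h', ?_⟩
  exact (trans_constHom (refineHom h) (fun _ => rfl) g).trans
    (trans_constHom (refineHom h') (fun _ => rfl) g).symm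

theorem mkArr_constArr (W W' : CircleCover) (r : G.InertiaArr) :
    G.loopSystem.mkArr W (constArr W r) = G.loopSystem.mkArr W' (constArr W' r) := by
  obtain ⟨W'', h, h'⟩ := exists_ge_ge W W'
  refine G.loopSystem.mkArr_eq_iff.2 ⟨W'', h, h', ?_⟩
  exact (precomp_constArr (refineHom h) (fun _ => rfl) r).trans
    (precomp_constArr (refineHom h') (fun _ => rfl) r).symm

/-- The inclusion of the inertia groupoid into the loop groupoid as constant loops. -/
noncomputable def inertiaToFixed : Hom G.inertia G.fixedLoopGpd :=
  ((G.constLoops basic).trans (G.loopSystem.ι basic)).toFixed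
    (fun g z => (congrArg (G.loopSystem.mkObj (basic.rotate z))
      (trans_constHom (basic.unrotateHom z) (fun _ => rfl) g)).trans
        (G.mkObj_constHom (basic.rotate z) basic g))
    (fun r z => (congrArg (G.loopSystem.mkArr (basic.rotate z))
      (precomp_constArr (basic.unrotateHom z) (fun _ => rfl) r)).trans
        (G.mkArr_constArr (basic.rotate z) basic r))

/-- Equality of a class with its rotation unfolds to an equality on some refinement for each `z`,
the hypothesis of `exists_refinement_eq_baseArr`; the resulting dependence on winding numbers alone
identifies the representative with a constant loop. -/
theorem inertiaToFixed_obj_surjective : Function.Surjective G.inertiaToFixed.obj := by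
  rintro ⟨⟨W, F⟩, hF⟩
  change Hom W.circle G at F
  obtain ⟨W', h, H⟩ := CircleCover.exists_refinement_eq_baseArr (W := W) (φ := F.arr) fun z => by
    obtain ⟨W'', hz, h, e⟩ := G.loopSystem.mkObj_eq_iff.1 (hF z)
    exact ⟨W'', hz, h, fun r => congrArg (fun E : Hom W''.circle G => E.arr r) e⟩
  obtain ⟨g, hg⟩ := exists_eq_constHom ((refineHom h).trans F) (fun l => F.arr (W.baseArr 0 l)) H
  refine ⟨g, Subtype.ext ((G.mkObj_constHom basic W' g).trans ?_)⟩
  rw [← hg]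
  exact G.loopSystem.mkObj_map W W' h F

theorem inertiaToFixed_arr_surjective : Function.Surjective G.inertiaToFixed.arr := by
  rintro ⟨⟨W, L⟩, hL⟩
  change MapArr W.circle G at L
  -- Source, target and arrow are treated as one function, so that a single refinement serves all
  -- three.
  obtain ⟨W', h, H⟩ := CircleCover.exists_refinement_eq_baseArr (W := W)
    (φ := fun r => (L.dom.arr r, L.cod.arr r, L.app r)) fun z => by
    obtain ⟨W'', hz, h, e⟩ := G.loopSystem.mkArr_eq_iff.1 (hL z)
    exact ⟨W'', hz, h, fun r => congrArg (fun M : MapArr W''.circle G =>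
      (M.dom.arr r, M.cod.arr r, M.app r)) e⟩
  obtain ⟨r, hr⟩ := exists_eq_constArr (L.precomp (refineHom h))
    (fun l => L.dom.arr (W.baseArr 0 l)) (fun l => L.cod.arr (W.baseArr 0 l))
    (fun l => L.app (W.baseArr 0 l)) (fun r => congrArg (fun p => p.1) (H r))
    (fun r => congrArg (fun p => p.2.1) (H r)) (fun r => congrArg (fun p => p.2.2) (H r))
  refine ⟨r, Subtype.ext ((G.mkArr_constArr basic W' r).trans ?_)⟩
  rw [← hr]
  exact G.loopSystem.mkArr_map W W' h L

/-! ### Evaluation at the base point of the circle -/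

/-- The holonomy of a loop at the base point of the circle. -/
noncomputable def holonomy : G.loopGpd.Obj → G.Arr :=
  DirectLimit.lift _ (fun W (F : Hom W.circle G) => F.arr (W.baseArr 0 1)) fun _ _ h F =>
    congrArg (Hom.arr F) (CircleCover.refineHom_baseArr h 0 1).symm

theorem continuous_holonomy : Continuous G.holonomy :=
  continuous_coinduced_dom.2 (continuous_sigma fun W =>
    (continuous_eval_const (W.baseArr 0 1)).comp
      (continuous_snd.comp (Hom.continuous_pair W.circle G)))

/-- The holonomy of the source of an arrow between loops, and the value of the arrow at the base
point of the circle. -/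
noncomputable def baseValue : G.loopGpd.Arr → G.Arr × G.Arr :=
  DirectLimit.lift _ (fun W (L : MapArr W.circle G) =>
    (L.app (W.baseArr 0 0), L.dom.arr (W.baseArr 0 1))) fun _ _ h L => Prod.ext
      (congrArg (MapArr.app L) (CircleCover.refineHom_baseArr h 0 0).symm)
      (congrArg (MapArr.dom L).arr (CircleCover.refineHom_baseArr h 0 1).symm)

theorem continuous_baseValue : Continuous G.baseValue :=
  continuous_coinduced_dom.2 (continuous_sigma fun W =>
    -- The base arrow with winding number `0` is a unit, so this component is read off from the
    -- restriction of the arrow to units, which the topology of `MapArr` controls.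
    ((continuous_eval_const (W.circle.src (W.baseArr 0 0))).comp
      (continuous_snd.comp (MapArr.continuous_pair W.circle G))).prodMk
    ((continuous_eval_const (W.baseArr 0 1)).comp
      (continuous_fst.comp (MapArr.continuous_pair W.circle G))))

/-- The holonomy of the constant loop of `g` is `g`. Thus the composite is the inclusion of loops
into arrows, an embedding, which gives injectivity and continuity of the inverse at once. -/
theorem isHomeomorph_inertiaToFixed_obj : IsHomeomorph G.inertiaToFixed.obj := by
  refine .of_isEmbedding_comp G.inertiaToFixed.obj.continuous
    (g := fun x => G.holonomy x.1) (G.continuous_holonomy.comp continuous_subtype_val)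
    G.inertiaToFixed_obj_surjective ?_
  have h : (fun x => G.holonomy x.1) ∘ G.inertiaToFixed.obj = fun g : G.Loop => g.1 :=
    funext fun g => Loop.pow_one g
  rw [h]
  exact Topology.IsEmbedding.subtypeVal

/-- The holonomy of the source and the value at the base point recover the loop and the conjugating
arrow, which by `inertiaArrHomeo` embed the arrows of the inertia groupoid. -/
theorem isHomeomorph_inertiaToFixed_arr : IsHomeomorph G.inertiaToFixed.arr := by
  refine .of_isEmbedding_comp G.inertiaToFixed.arr.continuous
    (g := fun x => G.baseValue x.1) (G.continuous_baseValue.comp continuous_subtype_val)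
    G.inertiaToFixed_arr_surjective ?_
  have h : (fun x => G.baseValue x.1) ∘ G.inertiaToFixed.arr =
      Prod.map id Subtype.val ∘ Subtype.val ∘ G.inertiaArrHomeo.symm :=
    funext fun r => Prod.ext
      (constArr_app_unit basic r (basic.circle.src (basic.baseArr 0 0))) (Loop.pow_one r.1.1)
  rw [h]
  exact (Topology.IsEmbedding.id.prodMap Topology.IsEmbedding.subtypeVal).comp
    (Topology.IsEmbedding.subtypeVal.comp G.inertiaArrHomeo.symm.isEmbedding)

end FixedLoops

end TGpd

/-! ### Morita equivalence of fixed loops and twisted sectors -/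

theorem mainTheorem2 (n : ℕ) (G : TGpd.{u}) [G.IsTopological]
    [ChartedSpace (EuclideanSpace ℝ (Fin n)) G.Obj]
    [ChartedSpace (EuclideanSpace ℝ (Fin n)) G.Arr] (hG : G.IsOrbifold n) :
    Nonempty G.OrbifoldAtlas ∧
      ∀ A : G.OrbifoldAtlas, TGpd.MoritaEquivalent G.fixedLoopGpd A.twistedSectors := by
  have := hG.t2_obj
  have := hG.t2_arr
  -- Local connectedness makes the connected component used as a chart open.
  have := ChartedSpace.locallyConnectedSpace (EuclideanSpace ℝ (Fin n)) G.Obj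
  have hs : IsLocalHomeomorph G.src := hG.isLocalDiffeomorph_src.isLocalHomeomorph
  refine ⟨TGpd.nonempty_orbifoldAtlas fun x => TGpd.exists_orbifoldChart hs hG.isProperMap x,
    fun A => ?_⟩
  exact (A.isMorita_toInertia (TGpd.discreteTopology_isotropy hs) hs.isOpenMap).moritaEquivalent
    G.isHomeomorph_inertiaToFixed_obj G.isHomeomorph_inertiaToFixed_arr
    A.twistedSectors_isTopological G.inertia_isTopological
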